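/- Let $N\ge 1$ and $d$ be integers, $A\in\mathbb{R}^{N\times N}$, $B\in\mathbb{R}^{N\times d}$ with $\operatorname{rank}B=d$, and assume the Kalman condition $\operatorname{rank}[B,AB,\dots,A^{N-1}B]=N$. Let $\alpha\in(0,2)$, $r_0>0$, and let $\mu$ be a finite measure on the unit sphere $\mathbb{S}^{d-1}$ that is non-degenerate: there is $\eta\ge1$ with $\eta^{-1}|p|^\alpha\le\int_{\mathbb{S}^{d-1}}|p\cdot s|^\alpha\,\mu(ds)\le\eta|p|^\alpha$ for all $p\in\mathbb{R}^d$. Let $n$ be the least $r$ with $\operatorname{rank}[B,AB,\dots,A^{r-1}B]=N$; let $V_0=\{0\}$, $V_h=\operatorname{Im}B+\dots+\operatorname{Im}A^{h-1}B$, and let $E_h$ be the orthogonal projection of $\mathbb{R}^N$ onto $V_{h-1}^\perp\cap V_h$, $1\le h\le n$. Put $\mathbb{M}_t=\sum_{h=1}^n t^{h-1}E_h$ for $t\ge 0$, $R_0=I$, $R_t=\mathbb{M}_t^{-1}e^{tA}\mathbb{M}_t$ for $t>0$, and $$\rho:=r_0\cdot\inf\{|\mathbb{M}_sR_{st}B\theta|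 : s\in(0,1),\ t\in(0,1],\ \theta\in\mathbb{S}^{d-1}\}.$$ For $t\in(0,1]$ let $\tilde\mu^t$ be the image of the measure $|\mathbb{M}_sR_{st}B\theta|^\alpha\,\mu(d\theta)\,ds$ on $[0,1]\times\mathbb{S}^{d-1}$ under $(s,\theta)\mapsto \mathbb{M}_sR_{st}B\theta/|\mathbb{M}_sR_{st}B\theta|\in\mathbb{S}^{N-1}$, and let $$\nu^t_\alpha(C)=\int_0^{\rho}\int_{\mathbb{S}^{N-1}}\mathbf 1_C(r\theta)\,\tilde\mu^t(d\theta)\frac{dr}{r^{1+\alpha}},\qquad \Phi^{\mathrm{tr}}_t(\xi)=\int_{|z|\le t^{1/\alpha}}\bigl[1-e^{i\langle\xi,z\rangle}+i\langle\xi,z\rangle\bigr]\,\nu^t_\alpha(dz),\quad \xi\in\mathbb{R}^N .$$ The truncated stable law $\mathbb{P}^{\mathrm{tr}}_t$ is the probability measure on $\mathbb{R}^N$ with characteristic function $\widehat{\mathbb{P}^{\mathrm{tr}}_t}(\xi)=\exp[-t\,\Phi^{\mathrm{tr}}_t(\xi)]$. **Proposition.** For every integer $m\ge0$ there is $T_0=T_0(m)\in(0,1]$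 such that for every $t\in(0,T_0]$ the probability measure $\mathbb{P}^{\mathrm{tr}}_t$ exists and has a density $p^{\mathrm{tr}}(t,\cdot)\ge0$ that is $m$ times continuously differentiable on $\mathbb{R}^N$. Moreover, for every integer $k$ with $0\le k\le m$ there is a constant $C=C(m,k)>0$ such that, for every multi-index $\vartheta\in\mathbb{N}_0^N$ with $|\vartheta|=k$, $$|D^\vartheta p^{\mathrm{tr}}(t,y)|\le C\,t^{-\frac{N+|\vartheta|}{\alpha}}\Bigl(1+\frac{|y|}{t^{1/\alpha}}\Bigr)^{|\vartheta|-m},\qquad t\in(0,T_0],\ y\in\mathbb{R}^N .$$ ($T_0$ and $C$ may also depend on the fixed data $N,d,A,B,\alpha,r_0,\mu$.) -/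

import Mathlib

open MeasureTheory Set

noncomputable section

/-- `ℝᴺ` with its Euclidean norm. -/
abbrev RSp (N : ℕ) : Type := EuclideanSpace ℝ (Fin N)

/-- The block matrix `[B, AB, …, A^{r-1}B]`; the column `(k, j)` is the `j`-th column of `A^k B`. -/
def kalmanMatrix {N d : ℕ} (A : Matrix (Fin N) (Fin N) ℝ) (B : Matrix (Fin N) (Fin d) ℝ) (r : ℕ) :
    Matrix (Fin N) (Fin r × Fin d) ℝ :=
  Matrix.of fun i kj => (A ^ (kj.1 : ℕ) * B) i kj.2

/-- The least `r` such that `[B, AB, …, A^{r-1}B]` has rank `N`. -/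
def kalmanIndex {N d : ℕ} (A : Matrix (Fin N) (Fin N) ℝ) (B : Matrix (Fin N) (Fin d) ℝ) : ℕ :=
  sInf {r : ℕ | (kalmanMatrix A B r).rank = N}

/-- The subspace `V_h = Im B + Im (AB) + ⋯ + Im (A^{h-1}B)` of `ℝᴺ` (so `V_0 = 0`). -/
def flagSpace {N d : ℕ} (A : Matrix (Fin N) (Fin N) ℝ) (B : Matrix (Fin N) (Fin d) ℝ) (h : ℕ) :
    Submodule ℝ (RSp N) :=
  ⨆ k : Fin h, LinearMap.range (Matrix.toEuclideanLin (A ^ (k : ℕ) * B))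

/-- The orthogonal projection of `ℝᴺ` onto `V_hᗮ ∩ V_{h+1}`. The index is shifted by one:
this is the projection usually numbered `h + 1`. -/
def flagProj {N d : ℕ} (A : Matrix (Fin N) (Fin N) ℝ) (B : Matrix (Fin N) (Fin d) ℝ) (h : ℕ) :
    RSp N →L[ℝ] RSp N :=
  ((flagSpace A B h)ᗮ ⊓ flagSpace A B (h + 1)).starProjection

/-- The intrinsic dilation `𝕄_t`, acting as multiplication by `t^h` on `V_hᗮ ∩ V_{h+1}`
for `0 ≤ h < n`, `n` the Kalman index. In an orthonormal basis adapted to the flag it is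
`diag(I, t I, …, t^{n-1} I)`. -/
def dilation {N d : ℕ} (A : Matrix (Fin N) (Fin N) ℝ) (B : Matrix (Fin N) (Fin d) ℝ) (t : ℝ) :
    RSp N →L[ℝ] RSp N :=
  ∑ h ∈ Finset.range (kalmanIndex A B), t ^ h • flagProj A B h

/-- `R_t = 𝕄_t⁻¹ e^{tA} 𝕄_t` for `t ≠ 0`, and `R_0 = I`. -/
def resolventMap {N d : ℕ} (A : Matrix (Fin N) (Fin N) ℝ) (B : Matrix (Fin N) (Fin d) ℝ) (t : ℝ) :
    RSp N →L[ℝ] RSp N :=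
  if t = 0 then 1
  else Ring.inverse (dilation A B t) * NormedSpace.exp (t • Matrix.toEuclideanCLM (𝕜 := ℝ) A) *
    dilation A B t

/-- The vector `𝕄_s R_{st} B θ` of `ℝᴺ`, for `θ ∈ ℝᵈ`. -/
def transported {N d : ℕ} (A : Matrix (Fin N) (Fin N) ℝ) (B : Matrix (Fin N) (Fin d) ℝ)
    (t s : ℝ) (θ : RSp d) : RSp N :=
  dilation A B s (resolventMap A B (s * t) (Matrix.toEuclideanLin B θ))

/-- The infimum of `|𝕄_s R_{st} B θ|` over `s ∈ (0,1)`, `t ∈ (0,1]` and unit vectors `θ`. -/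
def transportedInf {N d : ℕ} (A : Matrix (Fin N) (Fin N) ℝ) (B : Matrix (Fin N) (Fin d) ℝ) : ℝ :=
  sInf {x : ℝ | ∃ s ∈ Ioo (0 : ℝ) 1, ∃ t ∈ Ioc (0 : ℝ) 1, ∃ θ ∈ Metric.sphere (0 : RSp d) 1,
    x = ‖transported A B t s θ‖}

/-- A measure on `ℝᵈ` which is finite and carried by the unit sphere, and non-degenerate with
exponent `α`: `η⁻¹ |p|^α ≤ ∫ |p · s|^α μ(ds) ≤ η |p|^α` for some `η ≥ 1` and all `p`. -/
structure IsNondegSpherical {d : ℕ} (α : ℝ) (μ : Measure (RSp d)) : Prop where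
  finite : IsFiniteMeasure μ
  carried : μ (Metric.sphere (0 : RSp d) 1)ᶜ = 0
  nondeg : ∃ η : ℝ, 1 ≤ η ∧ ∀ p : RSp d,
    η⁻¹ * ‖p‖ ^ α ≤ ∫ s, |inner ℝ p s| ^ α ∂μ ∧ ∫ s, |inner ℝ p s| ^ α ∂μ ≤ η * ‖p‖ ^ α

/-- The spherical measure `μ̃^t` on `ℝᴺ`: the image of `|𝕄_s R_{st} B θ|^α μ(dθ) ds` on
`[0,1] × S^{d-1}` under `(s, θ) ↦ 𝕄_s R_{st} B θ / |𝕄_s R_{st} B θ|`. -/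
def sphericalPart {N d : ℕ} (A : Matrix (Fin N) (Fin N) ℝ) (B : Matrix (Fin N) (Fin d) ℝ)
    (α : ℝ) (μ : Measure (RSp d)) (t : ℝ) : Measure (RSp N) :=
  ((((volume : Measure ℝ).restrict (Icc 0 1)).prod μ).withDensity
      fun sθ => ENNReal.ofReal (‖transported A B t sθ.1 sθ.2‖ ^ α)).map
    fun sθ => ‖transported A B t sθ.1 sθ.2‖⁻¹ • transported A B t sθ.1 sθ.2

/-- The measure `C ↦ ∫_0^ρ ∫ 1_C(r θ) σ(dθ) dr / r^{1+α}`. -/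
def polarMeasure {N : ℕ} (α ρ : ℝ) (σ : Measure (RSp N)) : Measure (RSp N) :=
  ((((volume : Measure ℝ).restrict (Ioc 0 ρ)).withDensity
      fun r => ENNReal.ofReal (1 / r ^ (1 + α))).prod σ).map fun rθ => rθ.1 • rθ.2

/-- The `α`-stable-type Lévy measure `ν^t_α` on `ℝᴺ`, with spherical part `μ̃^t` and jumps of size
at most `r₀ · inf |𝕄_s R_{st} B θ|`. -/
def stableLevyMeasure {N d : ℕ} (A : Matrix (Fin N) (Fin N) ℝ) (B : Matrix (Fin N) (Fin d) ℝ)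
    (α r₀ : ℝ) (μ : Measure (RSp d)) (t : ℝ) : Measure (RSp N) :=
  polarMeasure α (r₀ * transportedInf A B) (sphericalPart A B α μ t)

/-- The symbol `∫_{|z| ≤ t^{1/α}} (1 - e^{i⟨ξ,z⟩} + i⟨ξ,z⟩) ν^t_α(dz)`. -/
def truncSymbol {N d : ℕ} (A : Matrix (Fin N) (Fin N) ℝ) (B : Matrix (Fin N) (Fin d) ℝ)
    (α r₀ : ℝ) (μ : Measure (RSp d)) (t : ℝ) (ξ : RSp N) : ℂ :=
  ∫ z in Metric.closedBall (0 : RSp N) (t ^ (1 / α)),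
    (1 - Complex.exp (Complex.I * (inner ℝ ξ z : ℝ)) + Complex.I * (inner ℝ ξ z : ℝ))
    ∂(stableLevyMeasure A B α r₀ μ t)

/-- `P` is the truncated stable law at time `t`: the probability measure whose characteristic
function is `exp (- t Φ^tr_t)`. At most one `P` has this property (`IsTruncLaw.unique`). -/
structure IsTruncLaw {N d : ℕ} (A : Matrix (Fin N) (Fin N) ℝ) (B : Matrix (Fin N) (Fin d) ℝ)
    (α r₀ : ℝ) (μ : Measure (RSp d)) (t : ℝ) (P : Measure (RSp N)) : Prop where
  isProb : IsProbabilityMeasure P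
  charFun_eq : ∀ ξ : RSp N, charFun P ξ = Complex.exp (-(t * truncSymbol A B α r₀ μ t ξ))

theorem IsTruncLaw.unique {N d : ℕ} {A : Matrix (Fin N) (Fin N) ℝ} {B : Matrix (Fin N) (Fin d) ℝ}
    {α r₀ : ℝ} {μ : Measure (RSp d)} {t : ℝ} {P P' : Measure (RSp N)}
    (h : IsTruncLaw A B α r₀ μ t P) (h' : IsTruncLaw A B α r₀ μ t P') : P = P' := by
  have := h.isProb
  have := h'.isProb
  exact Measure.ext_of_charFun (funext fun ξ => (h.charFun_eq ξ).trans (h'.charFun_eq ξ).symm)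

/-- The partial derivative `∂f/∂x_i`. -/
def pderivative {N : ℕ} (i : Fin N) (f : RSp N → ℝ) : RSp N → ℝ :=
  fun y => lineDeriv ℝ f y (EuclideanSpace.single i (1 : ℝ))

/-- The mixed partial derivative `D^ϑ f = ∂_1^{ϑ_1} ⋯ ∂_N^{ϑ_N} f` for a multi-index `ϑ`. -/
def multiDeriv {N : ℕ} (ϑ : Fin N → ℕ) (f : RSp N → ℝ) : RSp N → ℝ :=
  (List.finRange N).foldr (fun i g => (pderivative i)^[ϑ i] g) f

end

/-! ### Linear algebra of the Kalman flag and of the dilations -/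

section Flag

variable {N d : ℕ} {A : Matrix (Fin N) (Fin N) ℝ} {B : Matrix (Fin N) (Fin d) ℝ}

/-! Scaling reduces everything to one bounded family of Schwartz functions. Put `l = t^(1/α)`. The
radial density `dr / r^(1+α)` is homogeneous, so as soon as `l ≤ ρ` one has `t Φ^tr_t(ξ) = Ψ_σ(l
ξ)`, where `σ = μ̃^t` and `Ψ_σ` is the Lévy symbol with spherical part `σ` and jumps of size at most
1 (`mul_setIntegral_levyKernel_polarMeasure`). The density is `l^(-N) q_σ(y / l)`, with `q_σ` the
Fourier inverse of `exp(-Ψ_σ)`, and the estimates only say that the `q_σ` are bounded in Schwartz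
space uniformly in `t` (`exists_schwartz_density`). In particular `T₀ = min(1, ρ^α)` serves every
`m`.

The Fourier transform is continuous on Schwartz space, so it is enough to bound `w ↦
exp(-Ψ_σ(2πw))`. Its derivatives produce only polynomial factors, because the jumps are bounded by 1
and have bounded second moment. Its size is controlled by `Re Ψ_σ(ξ) ≥ b (|ξ|^α - 1)`, which follows
from `1 - cos x ≥ 2x²/π²` on `|x| ≤ π` and from a bound `∫ ⟨ω,θ⟩² σ(dθ) ≥ c |ω|²`
(`le_re_levySymbol`).

That `c` does not depend on `t` is the Kalman condition (`exists_le_integral_adjoint_flagSeries`).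
One has `𝕄_s R_{st} B = 𝕄_{1/t} e^{stA} B`, which looks singular at `t = 0`; but the flag kills
every negative power of `t`, leaving a power series in `s` with coefficients polynomial in `t`. The
extension to `t = 0` is still non-degenerate, and compactness in `(t, ω)` gives `c`.

Nonnegativity of `q_σ`: after removal of the small jumps, `exp(-Ψ)` is a compound Poisson
characteristic function. Having nonnegative Gaussian-damped Fourier integrals survives bounded
pointwise limits, and the damping is removed at the end since `exp(-Ψ_σ)` is integrable. -/

theorem flagSpace_mono {h k : ℕ} (hk : h ≤ k) : flagSpace A B h ≤ flagSpace A B k :=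
  iSup_le fun i => le_iSup
    (fun k : Fin k => LinearMap.range (Matrix.toEuclideanLin (A ^ (k : ℕ) * B))) (Fin.castLE hk i)

theorem toEuclideanLin_mem_flagSpace {k h : ℕ} (hk : k < h) (θ : RSp d) :
    Matrix.toEuclideanLin (A ^ k * B) θ ∈ flagSpace A B h :=
  le_iSup (fun k : Fin h => LinearMap.range (Matrix.toEuclideanLin (A ^ (k : ℕ) * B))) ⟨k, hk⟩
    ⟨θ, rfl⟩

theorem flagSpace_succ_le {h : ℕ} : flagSpace A B (h + 1) ≤
    flagSpace A B h ⊔ LinearMap.range (Matrix.toEuclideanLin (A ^ h * B)) := by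
  refine iSup_le fun i => ?_
  rcases Nat.lt_succ_iff_lt_or_eq.1 i.2 with hi | hi
  · rintro _ ⟨θ, rfl⟩
    exact Submodule.mem_sup_left (toEuclideanLin_mem_flagSpace hi θ)
  · rw [hi]; exact le_sup_right

theorem flagSpace_zero : flagSpace A B 0 = ⊥ := by simp [flagSpace]

theorem flagSpace_eq_top {r : ℕ} (hr : (kalmanMatrix A B r).rank = N) : flagSpace A B r = ⊤ := by
  have hsurj : LinearMap.range (kalmanMatrix A B r).mulVecLin = ⊤ := by
    apply Submodule.eq_top_of_finrank_eq
    rw [← Matrix.rank, hr]; simp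
  rw [eq_top_iff]
  intro x _
  obtain ⟨c, hc⟩ := LinearMap.range_eq_top.1 hsurj x.ofLp
  have hx : x = ∑ k : Fin r, Matrix.toEuclideanLin (A ^ (k : ℕ) * B)
      (WithLp.toLp 2 fun j => c (k, j)) := by
    ext i
    rw [← hc]
    simp only [Matrix.mulVecLin_apply, Matrix.mulVec, dotProduct, kalmanMatrix, Matrix.of_apply,
      Fintype.sum_prod_type, WithLp.ofLp_sum, Finset.sum_apply, Matrix.toLpLin_apply]
  rw [hx]
  exact Submodule.sum_mem _ fun k _ => toEuclideanLin_mem_flagSpace k.2 _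

theorem flagSpace_kalmanIndex (hK : (kalmanMatrix A B N).rank = N) :
    flagSpace A B (kalmanIndex A B) = ⊤ :=
  flagSpace_eq_top (Nat.sInf_mem (s := {r : ℕ | (kalmanMatrix A B r).rank = N}) ⟨N, hK⟩)

theorem flagProj_apply_of_mem {h : ℕ} {x : RSp N} (hx : x ∈ flagSpace A B h) :
    flagProj A B h x = 0 := by
  apply Submodule.eq_starProjection_of_mem_of_inner_eq_zero (Submodule.zero_mem _)
  intro w hw
  rw [sub_zero]
  exact (Submodule.mem_orthogonal _ _).1 hw.1 x hx

theorem flagProj_mem (h : ℕ) (x : RSp N) :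
    flagProj A B h x ∈ (flagSpace A B h)ᗮ ⊓ flagSpace A B (h + 1) :=
  Submodule.starProjection_apply_mem _ _

theorem flagProj_apply_flagProj (h k : ℕ) (x : RSp N) :
    flagProj A B h (flagProj A B k x) = if h = k then flagProj A B h x else 0 := by
  split_ifs with hk
  · subst hk
    exact Submodule.starProjection_eq_self_iff.2 (flagProj_mem h x)
  · rcases lt_or_gt_of_ne hk with hlt | hlt
    · apply Submodule.eq_starProjection_of_mem_of_inner_eq_zero (Submodule.zero_mem _)
      intro w hw
      rw [sub_zero, real_inner_comm]
      exact (Submodule.mem_orthogonal _ _).1 (flagProj_mem k x).1 w (flagSpace_mono hlt hw.2)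
    · exact flagProj_apply_of_mem (flagSpace_mono hlt (flagProj_mem k x).2)

/-- Induction on `m`: a vector of `V_{m+1}` is its projection to `V_m` plus a vector of `V_mᗮ ∩
V_{m+1}`, and the new residual is orthogonal to both pieces. At the Kalman index this is the
resolution of the identity behind all dilation identities. -/
theorem sum_flagProj (m : ℕ) (x : RSp N) :
    ∑ h ∈ Finset.range m, flagProj A B h x = (flagSpace A B m).starProjection x := by
  symm
  apply Submodule.eq_starProjection_of_mem_of_inner_eq_zero
  · exact Submodule.sum_mem _ fun h hh =>
      flagSpace_mono (Finset.mem_range.1 hh) (flagProj_mem h x).2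
  · induction m with
    | zero => intro w hw; rw [flagSpace_zero, Submodule.mem_bot] at hw; simp [hw]
    | succ m ih =>
      intro w hw
      rw [Finset.sum_range_succ, ← sub_sub]
      set y := x - ∑ h ∈ Finset.range m, flagProj A B h x with hy
      have hyp : flagProj A B m x = flagProj A B m y := by
        have : flagProj A B m (∑ h ∈ Finset.range m, flagProj A B h x) = 0 :=
          flagProj_apply_of_mem <| Submodule.sum_mem _ fun h hh =>
            flagSpace_mono (Finset.mem_range.1 hh) (flagProj_mem h x).2
        rw [hy, map_sub, this, sub_zero]
      rw [hyp]
      set P := (flagSpace A B m).starProjection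
      have h1 : P w ∈ flagSpace A B m := Submodule.starProjection_apply_mem _ _
      have h2 : w - P w ∈ (flagSpace A B m)ᗮ ⊓ flagSpace A B (m + 1) :=
        ⟨Submodule.sub_starProjection_mem_orthogonal _,
          Submodule.sub_mem _ hw (flagSpace_mono m.le_succ h1)⟩
      rw [← sub_add_cancel w (P w), inner_add_right]
      have e1 : inner ℝ (y - flagProj A B m y) (w - P w) = 0 :=
        Submodule.starProjection_inner_eq_zero y _ h2
      have e2 : inner ℝ (y - flagProj A B m y) (P w) = 0 := by
        rw [inner_sub_left, ih _ h1, zero_sub, neg_eq_zero, real_inner_comm]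
        exact (Submodule.mem_orthogonal _ _).1 (flagProj_mem m y).1 _ h1
      rw [e1, e2, add_zero]

theorem norm_flagProj_le (h : ℕ) : ‖flagProj A B h‖ ≤ 1 := Submodule.starProjection_norm_le _

theorem inner_flagProj (h : ℕ) (x y : RSp N) :
    inner ℝ (flagProj A B h x) y = inner ℝ x (flagProj A B h y) :=
  Submodule.inner_starProjection_left_eq_right _ _ _

theorem dilation_apply (t : ℝ) (x : RSp N) :
    dilation A B t x = ∑ h ∈ Finset.range (kalmanIndex A B), t ^ h • flagProj A B h x := by
  simp [dilation]

theorem flagProj_dilation {h : ℕ} (hh : h < kalmanIndex A B) (t : ℝ) (x : RSp N) :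
    flagProj A B h (dilation A B t x) = t ^ h • flagProj A B h x := by
  rw [dilation_apply, map_sum, Finset.sum_eq_single h]
  · rw [map_smul, flagProj_apply_flagProj, if_pos rfl]
  · intro k _ hk
    rw [map_smul, flagProj_apply_flagProj, if_neg hk.symm, smul_zero]
  · intro h'; exact absurd (Finset.mem_range.2 hh) h'

theorem dilation_mul (s t : ℝ) : dilation A B s * dilation A B t = dilation A B (s * t) := by
  ext1 x
  rw [mul_apply_eq_comp, dilation_apply s, dilation_apply (s * t)]
  refine Finset.sum_congr rfl fun h hh => ?_
  rw [flagProj_dilation (Finset.mem_range.1 hh), smul_smul, mul_pow]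

theorem dilation_one (hK : (kalmanMatrix A B N).rank = N) : dilation A B 1 = 1 := by
  ext1 x
  rw [dilation_apply]
  simp only [one_pow, one_smul]
  rw [sum_flagProj, flagSpace_kalmanIndex hK, Submodule.starProjection_top]
  rfl

theorem ringInverse_dilation (hK : (kalmanMatrix A B N).rank = N) {t : ℝ} (ht : t ≠ 0) :
    Ring.inverse (dilation A B t) = dilation A B t⁻¹ := by
  have h1 : dilation A B t * dilation A B t⁻¹ = 1 := by
    rw [dilation_mul, mul_inv_cancel₀ ht, dilation_one hK]
  have h2 : dilation A B t⁻¹ * dilation A B t = 1 := by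
    rw [dilation_mul, inv_mul_cancel₀ ht, dilation_one hK]
  exact Ring.inverse_unit ⟨_, _, h1, h2⟩

theorem kalmanIndex_pos (hN : 1 ≤ N) (hK : (kalmanMatrix A B N).rank = N) :
    0 < kalmanIndex A B := by
  rw [Nat.pos_iff_ne_zero]
  intro h0
  have h := flagSpace_kalmanIndex hK
  rw [h0, flagSpace_zero] at h
  have := congrArg (fun S : Submodule ℝ (RSp N) => Module.finrank ℝ S) h
  simp at this
  omega

/-- `Im B = V_1` meets only the projection of index 0, whose weight is `t^0 = 1`. This holds at `t =
0` too, since `0^0 = 1`; that case handles `s = 0` in `transported`. -/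
theorem dilation_apply_range (hN : 1 ≤ N) (hK : (kalmanMatrix A B N).rank = N) (t : ℝ)
    (θ : RSp d) : dilation A B t (Matrix.toEuclideanLin B θ) = Matrix.toEuclideanLin B θ := by
  have hmem : ∀ h, 0 < h → Matrix.toEuclideanLin B θ ∈ flagSpace A B h := fun h hh => by
    simpa using toEuclideanLin_mem_flagSpace (A := A) (B := B) hh θ
  have key : ∀ t : ℝ, dilation A B t (Matrix.toEuclideanLin B θ)
      = flagProj A B 0 (Matrix.toEuclideanLin B θ) := by
    intro t
    rw [dilation_apply, Finset.sum_eq_single 0]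
    · simp
    · intro k _ hk
      rw [flagProj_apply_of_mem (hmem k (Nat.pos_of_ne_zero hk)), smul_zero]
    · intro h; exact absurd (Finset.mem_range.2 (kalmanIndex_pos hN hK)) h
  rw [key t, ← key 1, dilation_one hK]; rfl

/-- The orthogonal decomposition of the norm along the flag. -/
theorem norm_le_norm_dilation (hK : (kalmanMatrix A B N).rank = N) {t : ℝ} (ht : 1 ≤ t)
    (x : RSp N) : ‖x‖ ≤ ‖dilation A B t x‖ := by
  have key : ∀ y : RSp N, ‖y‖ ^ 2 = ∑ h ∈ Finset.range (kalmanIndex A B), ‖flagProj A B h y‖ ^ 2 := by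
    intro y
    have hy : y = ∑ h ∈ Finset.range (kalmanIndex A B), flagProj A B h y := by
      rw [sum_flagProj, flagSpace_kalmanIndex hK, Submodule.starProjection_top]; rfl
    rw [← real_inner_self_eq_norm_sq]
    nth_rewrite 2 [hy]
    rw [inner_sum]
    refine Finset.sum_congr rfl fun h _ => ?_
    rw [← real_inner_self_eq_norm_sq, inner_flagProj, flagProj_apply_flagProj, if_pos rfl]
  refine le_of_sq_le_sq ?_ (norm_nonneg _)
  rw [key x, key (dilation A B t x)]
  refine Finset.sum_le_sum fun h hh => ?_
  rw [flagProj_dilation (Finset.mem_range.1 hh), norm_smul]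
  gcongr
  refine le_mul_of_one_le_left (norm_nonneg _) ?_
  rw [norm_pow, Real.norm_eq_abs, abs_of_nonneg (by linarith)]
  exact one_le_pow₀ ht

theorem toEuclideanLin_pow_mul (k : ℕ) (θ : RSp d) :
    Matrix.toEuclideanLin (A ^ k * B) θ
      = (Matrix.toEuclideanCLM (𝕜 := ℝ) A ^ k) (Matrix.toEuclideanLin B θ) := by
  rw [← map_pow, ← ContinuousLinearMap.coe_coe, Matrix.coe_toEuclideanCLM_eq_toEuclideanLin]
  simp [Matrix.toLpLin_apply]

/-- The inner `𝕄_{st}` fixes `Im B`, and `𝕄_s 𝕄_{st}⁻¹ = 𝕄_{1/t}`, so all dependence on `s` moves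
into the exponential. -/
theorem transported_eq_dilation_exp (hN : 1 ≤ N) (hK : (kalmanMatrix A B N).rank = N) {t : ℝ}
    (ht : t ≠ 0) (s : ℝ) (θ : RSp d) :
    transported A B t s θ = dilation A B t⁻¹
      (NormedSpace.exp ((s * t) • Matrix.toEuclideanCLM (𝕜 := ℝ) A)
        (Matrix.toEuclideanLin B θ)) := by
  rcases eq_or_ne s 0 with rfl | hs
  · have h0 : (0 : ℝ) • Matrix.toEuclideanCLM (𝕜 := ℝ) A = 0 := by
      generalize Matrix.toEuclideanCLM (𝕜 := ℝ) A = T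
      exact zero_smul ℝ T
    simp [transported, resolventMap, dilation_apply_range hN hK, h0]
  · rw [transported, resolventMap, if_neg (mul_ne_zero hs ht), ringInverse_dilation hK
      (mul_ne_zero hs ht), mul_apply_eq_comp, mul_apply_eq_comp,
      dilation_apply_range hN hK, ← mul_apply_eq_comp, dilation_mul]
    congr 2
    field_simp

end Flag

/-! ### Identity theorem for power series -/

section Series

open Filter Topology

/-- A power series that vanishes on `(0, 1]` has vanishing coefficients. -/
theorem eq_zero_of_tsum_pow_mul_eq_zero {a : ℕ → ℝ} (ha : Summable fun k => |a k|)
    (h : ∀ s ∈ Ioc (0 : ℝ) 1, ∑' k, s ^ k * a k = 0) (k : ℕ) : a k = 0 := by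
  induction k using Nat.strong_induction_on with
  | _ k ih =>
  have hs : Summable fun j => |a (j + (k + 1))| := (summable_nat_add_iff (f := fun k => |a k|) (k + 1)).2 ha
  set M := ∑' j, |a (j + (k + 1))| with hM
  -- With the lower coefficients already zero, dividing the series by `s^k` leaves `a k = -s ·
  -- (tail)`, and the tail is at most `M`.
  have key : ∀ s ∈ Ioc (0 : ℝ) 1, |a k| ≤ s * M := by
    intro s hs01
    have hbd : ∀ j, |s ^ j * a j| ≤ |a j| := fun j => by
      rw [abs_mul, abs_of_nonneg (pow_nonneg hs01.1.le j)]
      exact mul_le_of_le_one_left (abs_nonneg _) (pow_le_one₀ hs01.1.le hs01.2)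
    have hsum : Summable fun j => s ^ j * a j := (Summable.of_nonneg_of_le (fun _ => abs_nonneg _) hbd ha).of_abs
    have h0 := h s hs01
    rw [← hsum.sum_add_tsum_nat_add (k + 1), Finset.sum_range_succ,
      Finset.sum_eq_zero (fun j hj => by rw [ih j (Finset.mem_range.1 hj), mul_zero]), zero_add] at h0
    have e1 : ∑' j, s ^ (j + (k + 1)) * a (j + (k + 1))
        = s ^ k * (s * ∑' j, s ^ j * a (j + (k + 1))) := by
      rw [← tsum_mul_left, ← tsum_mul_left]
      exact tsum_congr fun j => by ring
    rw [e1, ← mul_add] at h0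
    have h1 := (mul_eq_zero.1 h0).resolve_left (pow_ne_zero _ hs01.1.ne')
    have hbd2 : ∀ j, ‖s ^ j * a (j + (k + 1))‖ ≤ |a (j + (k + 1))| := fun j => by
      rw [Real.norm_eq_abs, abs_mul, abs_of_nonneg (pow_nonneg hs01.1.le j)]
      exact mul_le_of_le_one_left (abs_nonneg _) (pow_le_one₀ hs01.1.le hs01.2)
    have h2 : ‖∑' j, s ^ j * a (j + (k + 1))‖ ≤ M := tsum_of_norm_bounded hs.hasSum hbd2
    rw [eq_neg_of_add_eq_zero_left h1, abs_neg, abs_mul, abs_of_pos hs01.1]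
    exact mul_le_mul_of_nonneg_left h2 hs01.1.le
  have hlim : Tendsto (fun s : ℝ => s * M) (𝓝[>] 0) (𝓝 0) := by
    have : Tendsto (fun s : ℝ => s * M) (𝓝 0) (𝓝 (0 * M)) := (continuous_id.mul continuous_const).tendsto 0
    rw [zero_mul] at this
    exact this.mono_left nhdsWithin_le_nhds
  have : |a k| ≤ 0 := ge_of_tendsto hlim <| by
    filter_upwards [Ioc_mem_nhdsGT (zero_lt_one' ℝ)] with s hs using key s hs
  exact abs_nonpos_iff.1 this

end Series

/-! ### Power series of the transported matrix and uniform Kalman condition -/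

section FlagSeries

variable {N d : ℕ} (A : Matrix (Fin N) (Fin N) ℝ) (B : Matrix (Fin N) (Fin d) ℝ)

/-- The map `∑_{h ≤ k} t^{k-h} E_h A^k B / k!`, the coefficient of `s^k` in `𝕄_s R_{st} B`. -/
noncomputable def flagCoeff (t : ℝ) (k : ℕ) : RSp d →L[ℝ] RSp N :=
  (k.factorial : ℝ)⁻¹ • ∑ h ∈ (Finset.range (kalmanIndex A B)).filter (fun h => h ≤ k), t ^ (k - h) •
    ((flagProj A B h ∘L (Matrix.toEuclideanCLM (𝕜 := ℝ) A : RSp N →L[ℝ] RSp N) ^ k) ∘L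
      LinearMap.toContinuousLinearMap (Matrix.toEuclideanLin B))

/-- The power series `∑_k s^k ∑_{h ≤ k} t^{k-h} E_h A^k B / k!`, which extends `𝕄_s R_{st} B`
continuously to `t = 0`. -/
noncomputable def flagSeries (t s : ℝ) : RSp d →L[ℝ] RSp N := ∑' k, s ^ k • flagCoeff A B t k

/-- A summable bound for the coefficients `flagCoeff`, uniform in `t ∈ [0, 1]`. -/
noncomputable def flagBound (k : ℕ) : ℝ :=
  (kalmanIndex A B * ‖LinearMap.toContinuousLinearMap (Matrix.toEuclideanLin B)‖) *
    (‖(Matrix.toEuclideanCLM (𝕜 := ℝ) A : RSp N →L[ℝ] RSp N)‖ ^ k / k.factorial)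

variable {A B}

theorem summable_flagBound : Summable (flagBound A B) :=
  (Real.summable_pow_div_factorial _).mul_left _

theorem smul_pow_clm {E : Type*} [NormedAddCommGroup E] [NormedSpace ℝ E] (c : ℝ) (T : E →L[ℝ] E)
    (k : ℕ) : (c • T) ^ k = c ^ k • T ^ k := smul_pow _ _ _

theorem norm_pow_clm_le {E : Type*} [NormedAddCommGroup E] [NormedSpace ℝ E] {T : E →L[ℝ] E}
    (k : ℕ) : ‖T ^ k‖ ≤ ‖T‖ ^ k := by
  induction k with
  | zero => exact (pow_zero T).symm ▸ (ContinuousLinearMap.norm_id_le.trans_eq (pow_zero _).symm)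
  | succ k ih =>
    rw [pow_succ, pow_succ]
    exact (norm_mul_le _ _).trans (mul_le_mul_of_nonneg_right ih (norm_nonneg _))

theorem exp_neg_mul_exp_self {𝔸 : Type*} [NormedRing 𝔸] [NormedAlgebra ℝ 𝔸] [CompleteSpace 𝔸]
    (x : 𝔸) : NormedSpace.exp (-x) * NormedSpace.exp x = 1 := by
  have : NormedAlgebra ℚ 𝔸 := NormedAlgebra.restrictScalars ℚ ℝ 𝔸
  rw [← NormedSpace.exp_add_of_commute (Commute.neg_left (Commute.refl _)), neg_add_cancel,
    NormedSpace.exp_zero]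

/-- The inverse `e^{-rT}` has norm at most `e^{‖T‖}` for `r ∈ [0, 1]`. -/
theorem norm_le_exp_mul_norm_exp_apply {E : Type*} [NormedAddCommGroup E] [NormedSpace ℝ E]
    [CompleteSpace E] (T : E →L[ℝ] E) {r : ℝ} (hr : r ∈ Icc (0 : ℝ) 1) (x : E) :
    ‖x‖ ≤ Real.exp ‖T‖ * ‖NormedSpace.exp (r • T) x‖ := by
  have h1 : NormedSpace.exp (-(r • T)) (NormedSpace.exp (r • T) x) = x := by
    rw [← mul_apply_eq_comp, exp_neg_mul_exp_self]; rfl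
  have h2 : ‖NormedSpace.exp (-(r • T))‖ ≤ Real.exp ‖T‖ := by
    have hs := NormedSpace.exp_series_hasSum_exp' (𝕂 := ℝ) (-(r • T))
    have hr' := NormedSpace.exp_series_hasSum_exp' (𝕂 := ℝ) ‖T‖
    rw [← Real.exp_eq_exp_ℝ] at hr'
    refine hs.norm_le_of_bounded hr' fun k => ?_
    rw [norm_smul, norm_inv, Real.norm_natCast, smul_eq_mul]
    gcongr
    refine (norm_pow_clm_le k).trans ?_
    gcongr
    rw [norm_neg, norm_smul, Real.norm_eq_abs, abs_of_nonneg hr.1]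
    exact mul_le_of_le_one_left (norm_nonneg _) hr.2
  calc ‖x‖ = ‖NormedSpace.exp (-(r • T)) (NormedSpace.exp (r • T) x)‖ := by rw [h1]
    _ ≤ ‖NormedSpace.exp (-(r • T))‖ * ‖NormedSpace.exp (r • T) x‖ :=
      ContinuousLinearMap.le_opNorm _ _
    _ ≤ _ := by gcongr

theorem norm_flagCoeff_le {t : ℝ} (ht : t ∈ Icc (0 : ℝ) 1) (k : ℕ) :
    ‖flagCoeff A B t k‖ ≤ flagBound A B k := by
  have h1 : ∀ h ∈ (Finset.range (kalmanIndex A B)).filter (fun h => h ≤ k), ‖t ^ (k - h) •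
    ((flagProj A B h ∘L (Matrix.toEuclideanCLM (𝕜 := ℝ) A : RSp N →L[ℝ] RSp N) ^ k) ∘L
      LinearMap.toContinuousLinearMap (Matrix.toEuclideanLin B))‖ ≤
      ‖(Matrix.toEuclideanCLM (𝕜 := ℝ) A : RSp N →L[ℝ] RSp N)‖ ^ k *
        ‖LinearMap.toContinuousLinearMap (Matrix.toEuclideanLin B)‖ := by
    intro h _
    rw [norm_smul]
    refine (mul_le_of_le_one_left (norm_nonneg _) ?_).trans ?_
    · rw [norm_pow, Real.norm_eq_abs, abs_of_nonneg ht.1]; exact pow_le_one₀ ht.1 ht.2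
    refine (ContinuousLinearMap.opNorm_comp_le _ _).trans ?_
    gcongr
    refine (ContinuousLinearMap.opNorm_comp_le _ _).trans ?_
    calc _ ≤ 1 * ‖(Matrix.toEuclideanCLM (𝕜 := ℝ) A : RSp N →L[ℝ] RSp N)‖ ^ k := by
          gcongr
          · exact norm_flagProj_le h
          · exact norm_pow_clm_le k
      _ = _ := one_mul _
  rw [flagCoeff, norm_smul, flagBound, norm_inv, Real.norm_natCast]
  refine (mul_le_mul_of_nonneg_left ((norm_sum_le_of_le _ h1).trans ?_) (by positivity)).trans_eq
    (b := (k.factorial : ℝ)⁻¹ * ((kalmanIndex A B : ℝ) *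
      (‖(Matrix.toEuclideanCLM (𝕜 := ℝ) A : RSp N →L[ℝ] RSp N)‖ ^ k *
        ‖LinearMap.toContinuousLinearMap (Matrix.toEuclideanLin B)‖))) ?_
  · rw [Finset.sum_const, nsmul_eq_mul]
    gcongr
    exact (Finset.card_filter_le _ _).trans_eq (Finset.card_range _)
  · ring

theorem norm_pow_smul_flagCoeff_le {t s : ℝ} (ht : t ∈ Icc (0 : ℝ) 1) (hs : s ∈ Icc (0 : ℝ) 1)
    (k : ℕ) : ‖s ^ k • flagCoeff A B t k‖ ≤ flagBound A B k := by
  rw [norm_smul, norm_pow, Real.norm_eq_abs, abs_of_nonneg hs.1]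
  exact (mul_le_of_le_one_left (norm_nonneg _) (pow_le_one₀ hs.1 hs.2)).trans
    (norm_flagCoeff_le ht k)

theorem hasSum_flagSeries {t s : ℝ} (ht : t ∈ Icc (0 : ℝ) 1) (hs : s ∈ Icc (0 : ℝ) 1) :
    HasSum (fun k => s ^ k • flagCoeff A B t k) (flagSeries A B t s) :=
  (Summable.of_norm_bounded summable_flagBound (norm_pow_smul_flagCoeff_le ht hs)).hasSum

theorem norm_flagSeries_le {t s : ℝ} (ht : t ∈ Icc (0 : ℝ) 1) (hs : s ∈ Icc (0 : ℝ) 1) :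
    ‖flagSeries A B t s‖ ≤ ∑' k, flagBound A B k :=
  tsum_of_norm_bounded summable_flagBound.hasSum (norm_pow_smul_flagCoeff_le ht hs)

theorem continuousOn_flagSeries :
    ContinuousOn (fun p : ℝ × ℝ => flagSeries A B p.1 p.2) (Icc 0 1 ×ˢ Icc 0 1) := by
  refine continuousOn_tsum (fun k => Continuous.continuousOn ?_) summable_flagBound
    fun k p hp => norm_pow_smul_flagCoeff_le hp.1 hp.2 k
  unfold flagCoeff
  fun_prop

/-- In `𝕄_{1/t} e^{stA} B` the projection of index `h` contributes `s^k t^{k-h}` times `E_h A^k B /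
k!`. For `h > k` the image of `A^k B` lies in `V_{k+1} ⊆ V_h`, which that projection annihilates, so
no negative power of `t` remains. -/
theorem transported_eq_flagSeries (hN : 1 ≤ N) (hK : (kalmanMatrix A B N).rank = N) {t s : ℝ}
    (ht : t ∈ Ioc (0 : ℝ) 1) (hs : s ∈ Icc (0 : ℝ) 1) (θ : RSp d) :
    transported A B t s θ = flagSeries A B t s θ := by
  rw [transported_eq_dilation_exp hN hK ht.1.ne']
  set T : RSp N →L[ℝ] RSp N := Matrix.toEuclideanCLM (𝕜 := ℝ) A with hT
  have h1 := (NormedSpace.exp_series_hasSum_exp' (𝕂 := ℝ) ((s * t) • T))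
  have h2 := ((h1.mapL (ContinuousLinearMap.apply ℝ (RSp N) (Matrix.toEuclideanLin B θ))).mapL
    (dilation A B t⁻¹))
  have h3 := (hasSum_flagSeries (A := A) (B := B) ⟨ht.1.le, ht.2⟩ hs).mapL
    (ContinuousLinearMap.apply ℝ (RSp N) θ)
  refine h2.unique ?_
  refine Eq.mp (congrArg (fun f => HasSum f _) (funext fun k => ?_)) h3
  symm
  have hpow : ((s * t) • T) ^ k = (s * t) ^ k • T ^ k := smul_pow_clm _ _ _
  simp only [hpow, ContinuousLinearMap.apply_apply, _root_.smul_apply, map_smul,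
    flagCoeff, dilation_apply, _root_.sum_apply, ContinuousLinearMap.comp_apply,
    LinearMap.coe_toContinuousLinearMap', Finset.smul_sum, smul_smul]
  symm
  refine Finset.sum_subset_zero_on_sdiff (Finset.filter_subset _ _) ?_ ?_
  · intro h hh
    rw [Finset.mem_sdiff, Finset.mem_filter] at hh
    have hk : k < h := by by_contra hc; exact hh.2 ⟨hh.1, not_lt.1 hc⟩
    rw [hT, ← toEuclideanLin_pow_mul, flagProj_apply_of_mem (toEuclideanLin_mem_flagSpace hk θ),
      smul_zero]
  · intro h hh
    congr 1
    obtain ⟨j, rfl⟩ := Nat.exists_eq_add_of_le (Finset.mem_filter.1 hh).2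
    have := ht.1.ne'
    rw [Nat.add_sub_cancel_left, mul_pow, pow_add, inv_pow]
    field_simp
    ring

/-- Strong induction along the flag. Once the components of index below `k` vanish, the coefficient
of order `k` sees only `E_k A^k B`, with weight `t^0 = 1` whatever `t` is, `t = 0` included. So `E_k
ω` is orthogonal to `Im A^k B` and to `V_k`, hence to `V_{k+1}`, which contains it. -/
theorem eq_zero_of_inner_flagCoeff (hK : (kalmanMatrix A B N).rank = N) {t : ℝ} {ω : RSp N}
    (h : ∀ k θ, inner ℝ ω (flagCoeff A B t k θ) = 0) : ω = 0 := by
  have hproj : ∀ k < kalmanIndex A B, flagProj A B k ω = 0 := by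
    intro k
    induction k using Nat.strong_induction_on with
    | _ k ih =>
    intro hk
    have horth : ∀ θ, inner ℝ (flagProj A B k ω) (Matrix.toEuclideanLin (A ^ k * B) θ) = 0 := by
      intro θ
      have h0 := h k θ
      simp only [flagCoeff, _root_.smul_apply, _root_.sum_apply,
        ContinuousLinearMap.comp_apply, LinearMap.coe_toContinuousLinearMap', inner_smul_right,
        inner_sum, ← toEuclideanLin_pow_mul, ← inner_flagProj] at h0
      have h1 := (mul_eq_zero.1 h0).resolve_left (by positivity)
      rw [Finset.sum_eq_single k] at h1
      · simpa using h1
      · intro j hj hjk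
        rw [Finset.mem_filter, Finset.mem_range] at hj
        rw [ih j (lt_of_le_of_ne hj.2 hjk) hj.1, inner_zero_left, mul_zero]
      · exact fun hc => (hc (by simp [hk])).elim
    obtain ⟨h1, h2⟩ := flagProj_mem (A := A) (B := B) k ω
    obtain ⟨u, hu, v, ⟨θ, rfl⟩, huv⟩ := Submodule.mem_sup.1 (flagSpace_succ_le h2)
    rw [← inner_self_eq_zero (𝕜 := ℝ)]
    nth_rewrite 2 [← huv]
    rw [inner_add_right, horth, add_zero, real_inner_comm]
    exact (Submodule.mem_orthogonal _ _).1 h1 u hu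
  have hω : ω = ∑ k ∈ Finset.range (kalmanIndex A B), flagProj A B k ω := by
    rw [sum_flagProj, flagSpace_kalmanIndex hK, Submodule.starProjection_top]; rfl
  rw [hω]
  exact Finset.sum_eq_zero fun k hk => hproj k (Finset.mem_range.1 hk)

theorem exists_inner_flagSeries_ne_zero (hK : (kalmanMatrix A B N).rank = N) {t : ℝ}
    (ht : t ∈ Icc (0 : ℝ) 1) {ω : RSp N} (hω : ω ≠ 0) :
    ∃ s ∈ Icc (0 : ℝ) 1, ∃ θ, inner ℝ ω (flagSeries A B t s θ) ≠ 0 := by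
  by_contra! hc
  refine hω (eq_zero_of_inner_flagCoeff (t := t) hK fun k θ => ?_)
  have hbd : ∀ k, |inner ℝ ω (flagCoeff A B t k θ)| ≤ ‖ω‖ * ‖θ‖ * flagBound A B k := fun k =>
    calc _ ≤ ‖ω‖ * ‖flagCoeff A B t k θ‖ := abs_real_inner_le_norm _ _
      _ ≤ ‖ω‖ * (flagBound A B k * ‖θ‖) := by
        gcongr
        exact (flagCoeff A B t k).le_of_opNorm_le (norm_flagCoeff_le ht k) θ
      _ = _ := by ring
  refine eq_zero_of_tsum_pow_mul_eq_zero (a := fun k => inner ℝ ω (flagCoeff A B t k θ))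
    (Summable.of_nonneg_of_le (fun _ => abs_nonneg _) hbd (summable_flagBound.mul_left _)) ?_ k
  intro s hs
  have h3 := ((hasSum_flagSeries (A := A) (B := B) ht ⟨hs.1.le, hs.2⟩).mapL
    (ContinuousLinearMap.apply ℝ (RSp N) θ)).mapL (innerSL ℝ ω)
  simp only [ContinuousLinearMap.apply_apply, map_smul,
    innerSL_apply_apply, smul_eq_mul] at h3
  rw [h3.tsum_eq, hc s ⟨hs.1.le, hs.2⟩]

open ContinuousLinearMap in
/-- The Kalman condition in quantitative form, uniformly in `t ∈ [0, 1]`. -/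
theorem exists_le_integral_adjoint_flagSeries (hK : (kalmanMatrix A B N).rank = N) :
    ∃ c : ℝ, 0 < c ∧ ∀ t ∈ Icc (0 : ℝ) 1, ∀ ω : RSp N,
      c * ‖ω‖ ^ 2 ≤ ∫ s in Icc (0 : ℝ) 1, ‖adjoint (flagSeries A B t s) ω‖ ^ 2 := by
  -- Clamping both variables to `[0, 1]` gives a globally continuous function, so that the
  -- parametric integral is continuous in `(t, ω)`.
  set F : ℝ → ℝ → RSp d →L[ℝ] RSp N := fun t s =>
    flagSeries A B (projIcc 0 1 zero_le_one t) (projIcc 0 1 zero_le_one s) with hF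
  have hFc : Continuous fun p : ℝ × ℝ => F p.1 p.2 := by
    refine continuousOn_flagSeries.comp_continuous (f := fun p : ℝ × ℝ =>
      (((projIcc 0 1 zero_le_one p.1 : Icc (0 : ℝ) 1) : ℝ),
        ((projIcc 0 1 zero_le_one p.2 : Icc (0 : ℝ) 1) : ℝ))) ?_ fun p => ⟨Subtype.coe_prop _, Subtype.coe_prop _⟩
    fun_prop
  have hFe : ∀ t ∈ Icc (0 : ℝ) 1, ∀ s ∈ Icc (0 : ℝ) 1, F t s = flagSeries A B t s := by
    intro t ht s hs
    simp only [hF, projIcc_of_mem _ ht, projIcc_of_mem _ hs]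
  set q : ℝ × RSp N → ℝ := fun p => ∫ s in Icc (0 : ℝ) 1, ‖adjoint (F p.1 s) p.2‖ ^ 2 with hq
  have hgc : Continuous fun p : (ℝ × RSp N) × ℝ => ‖adjoint (F p.1.1 p.2) p.1.2‖ ^ 2 := by
    have h1 : Continuous fun p : (ℝ × RSp N) × ℝ => F p.1.1 p.2 :=
      hFc.comp (f := fun p : (ℝ × RSp N) × ℝ => (p.1.1, p.2)) (by fun_prop)
    have h2 : Continuous fun p : (ℝ × RSp N) × ℝ => adjoint (F p.1.1 p.2) :=
      (LinearIsometryEquiv.continuous _).comp h1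
    fun_prop
  have hqc : Continuous q :=
    continuous_parametric_integral_of_continuous (μ := volume)
      (f := fun (p : ℝ × RSp N) s => ‖adjoint (F p.1 s) p.2‖ ^ 2) hgc isCompact_Icc
  have hpos : ∀ p ∈ Icc (0 : ℝ) 1 ×ˢ Metric.sphere (0 : RSp N) 1, 0 < q p := by
    rintro ⟨t, ω⟩ ⟨ht, hω⟩
    have hω0 : ω ≠ 0 := by
      rintro rfl
      simp at hω
    obtain ⟨s, hs, θ, hne⟩ := exists_inner_flagSeries_ne_zero hK ht hω0
    simp only [hq]
    rw [integral_Icc_eq_integral_Ioc, ← intervalIntegral.integral_of_le zero_le_one]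
    refine intervalIntegral.integral_pos zero_lt_one ?_ (fun _ _ => by positivity) ⟨s, hs, ?_⟩
    · exact (hgc.comp (f := fun s => ((t, ω), s)) (by fun_prop)).continuousOn
    · rw [hFe t ht s hs]
      have : adjoint (flagSeries A B t s) ω ≠ 0 := by
        intro h0
        rw [← adjoint_inner_left, h0, inner_zero_left] at hne
        exact hne rfl
      positivity
  -- Minimum over the compact set `[0, 1] × S^{N-1}`. The sphere is empty when `N = 0`, where any
  -- `c` works.
  obtain ⟨c, hc, hcq⟩ : ∃ c : ℝ, 0 < c ∧ ∀ p ∈ Icc (0 : ℝ) 1 ×ˢ Metric.sphere (0 : RSp N) 1, c ≤ q p := by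
    rcases (Icc (0 : ℝ) 1 ×ˢ Metric.sphere (0 : RSp N) 1).eq_empty_or_nonempty with he | hne
    · exact ⟨1, one_pos, by simp [he]⟩
    · obtain ⟨p, hp, hmin⟩ := (isCompact_Icc.prod (isCompact_sphere (0 : RSp N) 1)).exists_isMinOn hne
        hqc.continuousOn
      exact ⟨q p, hpos p hp, fun p' hp' => hmin hp'⟩
  refine ⟨c, hc, fun t ht ω => ?_⟩
  rcases eq_or_ne ω 0 with rfl | hω
  · simp
  have h1 := hcq (t, ‖ω‖⁻¹ • ω) ⟨ht, by simp [norm_smul, hω]⟩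
  have h2 : q (t, ‖ω‖⁻¹ • ω) = (‖ω‖ ^ 2)⁻¹ * ∫ s in Icc (0 : ℝ) 1, ‖adjoint (flagSeries A B t s) ω‖ ^ 2 := by
    simp only [hq]
    rw [← integral_const_mul]
    refine setIntegral_congr_fun measurableSet_Icc fun s hs => ?_
    simp only [hFe t ht s hs, map_smul, norm_smul, mul_pow, norm_inv, norm_norm, inv_pow]
  rw [h2, inv_mul_eq_div, le_div_iff₀ (by positivity)] at h1
  exact h1

end FlagSeries

/-! ### Uniform bounds for the spherical measures -/

section SphericalPart

/-- A measure carried by the unit sphere, of total mass at most `C`, whose quadratic form is at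
least `c`. -/
structure IsSphericalWithBounds {N : ℕ} (C c : ℝ) (σ : Measure (RSp N)) : Prop where
  mass_le : σ univ ≤ ENNReal.ofReal C
  carried : ∀ᵐ θ ∂σ, ‖θ‖ = 1
  lower : ∀ ω : RSp N, c * ‖ω‖ ^ 2 ≤ ∫ θ, (inner ℝ ω θ) ^ 2 ∂σ

variable {N d : ℕ} {A : Matrix (Fin N) (Fin N) ℝ} {B : Matrix (Fin N) (Fin d) ℝ}

theorem IsNondegSpherical.ae_norm_eq_one {α : ℝ} {μ : Measure (RSp d)}
    (hμ : IsNondegSpherical α μ) : ∀ᵐ θ ∂μ, ‖θ‖ = 1 := by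
  have h : ∀ᵐ θ ∂μ, θ ∈ Metric.sphere (0 : RSp d) 1 := mem_ae_iff.2 hμ.carried
  simpa using h

/-- Non-degeneracy with exponent `α` upgrades to exponent 2: the part of the integral where `|p ·
s|` is at most `ε |p|` is negligible, and on the rest `|x|^α ≤ (ε|p|)^{α-2} x²`. -/
theorem IsNondegSpherical.exists_le_integral_sq {α : ℝ} (hα₀ : 0 < α) (hα₂ : α < 2)
    {μ : Measure (RSp d)} (hμ : IsNondegSpherical α μ) :
    ∃ c : ℝ, 0 < c ∧ ∀ p : RSp d, c * ‖p‖ ^ 2 ≤ ∫ s, (inner ℝ p s) ^ 2 ∂μ := by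
  have := hμ.finite
  obtain ⟨η, hη1, hη⟩ := hμ.nondeg
  have hη0 : 0 < η := by linarith
  set M := μ.real univ with hM
  have hM0 : 0 ≤ M := measureReal_nonneg
  -- Chosen so that `ε^α μ(S) ≤ η⁻¹ / 2`: the small values use at most half of the lower bound.
  set ε : ℝ := (η⁻¹ / (2 * (M + 1))) ^ (1 / α) with hε
  have hε0 : 0 < ε := by positivity
  have hεα : ε ^ α * M ≤ η⁻¹ / 2 := by
    rw [hε, ← Real.rpow_mul (by positivity), one_div_mul_cancel hα₀.ne', Real.rpow_one]
    rw [div_mul_eq_mul_div, div_le_div_iff₀ (by positivity) two_pos]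
    have : 0 < η⁻¹ := by positivity
    nlinarith
  refine ⟨η⁻¹ / 2 * ε ^ (2 - α), by positivity, fun p => ?_⟩
  rcases eq_or_ne p 0 with rfl | hp
  · simp
  have hp0 : 0 < ‖p‖ := norm_pos_iff.2 hp
  have hpt : ∀ x : ℝ, |x| ^ α ≤ (ε * ‖p‖) ^ α + (ε * ‖p‖) ^ (α - 2) * x ^ 2 := by
    intro x
    rcases le_or_gt |x| (ε * ‖p‖) with hx | hx
    · have := Real.rpow_le_rpow (abs_nonneg x) hx hα₀.le
      have h2 : 0 ≤ (ε * ‖p‖) ^ (α - 2) * x ^ 2 := by positivity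
      linarith
    · have hx0 : 0 < |x| := lt_trans (by positivity) hx
      have h1 : |x| ^ α = |x| ^ (α - 2) * x ^ 2 := by
        rw [← sq_abs x, ← Real.rpow_natCast, ← Real.rpow_add hx0]; norm_num
      have h2 : |x| ^ (α - 2) ≤ (ε * ‖p‖) ^ (α - 2) :=
        Real.rpow_le_rpow_of_nonpos (by positivity) hx.le (by linarith)
      have h3 : 0 ≤ (ε * ‖p‖) ^ α := by positivity
      rw [h1]
      nlinarith [sq_nonneg x]
  have hsq : Integrable (fun s => (inner ℝ p s) ^ 2) μ := by
    refine Integrable.of_bound (C := ‖p‖ ^ 2) (by fun_prop) ?_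
    filter_upwards [hμ.ae_norm_eq_one] with s hs
    rw [Real.norm_eq_abs, abs_pow]
    gcongr
    simpa [hs] using abs_real_inner_le_norm p s
  have h1 : ∫ s, |inner ℝ p s| ^ α ∂μ ≤
      (ε * ‖p‖) ^ α * M + (ε * ‖p‖) ^ (α - 2) * ∫ s, (inner ℝ p s) ^ 2 ∂μ := by
    have h2 : Integrable (fun s => (ε * ‖p‖) ^ α + (ε * ‖p‖) ^ (α - 2) * (inner ℝ p s) ^ 2) μ :=
      (integrable_const _).add (hsq.const_mul _)
    refine (integral_mono_of_nonneg (Filter.Eventually.of_forall fun s => by positivity) h2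
      (Filter.Eventually.of_forall fun s => hpt _)).trans_eq ?_
    rw [integral_add (integrable_const _) (hsq.const_mul _), integral_const_mul, integral_const,
      smul_eq_mul, mul_comm M]
  have h3 := (hη p).1.trans h1
  rw [Real.mul_rpow hε0.le hp0.le, Real.mul_rpow hε0.le hp0.le] at h3
  set J := ∫ s, (inner ℝ p s) ^ 2 ∂μ
  have h4 : η⁻¹ / 2 * ‖p‖ ^ α ≤ ε ^ (α - 2) * ‖p‖ ^ (α - 2) * J := by
    have : ε ^ α * ‖p‖ ^ α * M ≤ η⁻¹ / 2 * ‖p‖ ^ α := by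
      have : 0 ≤ ‖p‖ ^ α := by positivity
      nlinarith
    linarith
  have h5 : ‖p‖ ^ 2 = ‖p‖ ^ (2 - α) * ‖p‖ ^ α := by
    rw [← Real.rpow_add hp0]; norm_num
  have h6 : ε ^ (2 - α) * ‖p‖ ^ (2 - α) * (ε ^ (α - 2) * ‖p‖ ^ (α - 2)) = 1 := by
    rw [mul_mul_mul_comm, ← Real.rpow_add hε0, ← Real.rpow_add hp0]; simp
  calc η⁻¹ / 2 * ε ^ (2 - α) * ‖p‖ ^ 2
      = ε ^ (2 - α) * ‖p‖ ^ (2 - α) * (η⁻¹ / 2 * ‖p‖ ^ α) := by rw [h5]; ring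
    _ ≤ ε ^ (2 - α) * ‖p‖ ^ (2 - α) * (ε ^ (α - 2) * ‖p‖ ^ (α - 2) * J) := by gcongr
    _ = J := by rw [← mul_assoc, h6, one_mul]

theorem toEuclideanLin_ker_eq_bot (hB : B.rank = d) :
    LinearMap.ker (Matrix.toEuclideanLin B) = ⊥ := by
  have h1 := LinearMap.finrank_range_add_finrank_ker (B.mulVecLin)
  rw [← Matrix.rank, hB, Module.finrank_fin_fun] at h1
  have h2 : LinearMap.ker B.mulVecLin = ⊥ := Submodule.finrank_eq_zero.1 (by omega)
  rw [LinearMap.ker_eq_bot'] at h2 ⊢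
  intro m hm
  have := h2 m.ofLp (by
    have := congrArg WithLp.ofLp hm
    simpa [Matrix.toLpLin_apply] using this)
  ext i
  simp [this]

/-- `B` is injective, `e^{stA}` is invertible with uniformly bounded inverse, and `𝕄_{1/t}` does not
decrease norms because `1/t ≥ 1`. -/
theorem exists_le_norm_transported (hN : 1 ≤ N) (hB : B.rank = d)
    (hK : (kalmanMatrix A B N).rank = N) :
    ∃ c : ℝ, 0 < c ∧ ∀ t ∈ Ioc (0 : ℝ) 1, ∀ s ∈ Icc (0 : ℝ) 1, ∀ θ : RSp d,
      c * ‖θ‖ ≤ ‖transported A B t s θ‖ := by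
  obtain ⟨K, hK0, hKB⟩ := (Matrix.toEuclideanLin B).exists_antilipschitzWith
    (toEuclideanLin_ker_eq_bot hB)
  set T : RSp N →L[ℝ] RSp N := Matrix.toEuclideanCLM (𝕜 := ℝ) A with hT
  have hexp : ∀ r ∈ Icc (0 : ℝ) 1, ∀ x, ‖x‖ ≤ Real.exp ‖T‖ * ‖NormedSpace.exp (r • T) x‖ :=
    fun r hr x => norm_le_exp_mul_norm_exp_apply T hr x
  refine ⟨(K * Real.exp ‖T‖)⁻¹, by positivity, fun t ht s hs θ => ?_⟩
  rw [inv_mul_le_iff₀ (by positivity), transported_eq_dilation_exp hN hK ht.1.ne', mul_assoc]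
  have h1 : ‖θ‖ ≤ K * ‖Matrix.toEuclideanLin B θ‖ := by
    simpa using hKB.le_mul_dist θ 0
  refine h1.trans (mul_le_mul_of_nonneg_left ?_ K.2)
  refine (hexp (s * t) ⟨mul_nonneg hs.1 ht.1.le, mul_le_one₀ hs.2 ht.1.le ht.2⟩ _).trans ?_
  gcongr
  exact norm_le_norm_dilation hK ((one_le_inv₀ ht.1).2 ht.2) _

theorem pos_of_kalman (hN : 1 ≤ N) (hK : (kalmanMatrix A B N).rank = N) : 0 < d := by
  rw [Nat.pos_iff_ne_zero]
  rintro rfl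
  have := (kalmanMatrix A B N).rank_le_card_width
  simp at this
  omega

theorem transportedInf_pos (hN : 1 ≤ N) (hB : B.rank = d)
    (hK : (kalmanMatrix A B N).rank = N) : 0 < transportedInf A B := by
  obtain ⟨c, hc, h⟩ := exists_le_norm_transported hN hB hK
  refine hc.trans_le (le_csInf ?_ ?_)
  -- The set must be nonempty, as the real infimum of the empty set is 0; this is where `0 < d` is
  -- needed.
  · have : Nonempty (Fin d) := ⟨⟨0, pos_of_kalman hN hK⟩⟩
    obtain ⟨θ, hθ⟩ := NormedSpace.sphere_nonempty (x := (0 : RSp d)) (r := 1) |>.2 zero_le_one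
    exact ⟨_, 1 / 2, by norm_num, 1, by norm_num, θ, hθ, rfl⟩
  · rintro _ ⟨s, hs, t, ht, θ, hθ, rfl⟩
    simpa [mem_sphere_zero_iff_norm.1 hθ] using h t ht s ⟨hs.1.le, hs.2.le⟩ θ

/-- With `V = 𝕄_s R_{st} B θ` the quadratic form of `μ̃^t` is `∫ |V|^{α-2} ⟨ω, V⟩²`. As `α < 2` and
`|V| ≤ C₀`, the weight is at least `C₀^{α-2}`. Integrating in `θ` gives `c₂ |F* ω|²` with `F` the
flag series, and integrating in `s` gives `c₂ c₃ |ω|²`. -/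
theorem exists_isSphericalWithBounds (hN : 1 ≤ N) (hB : B.rank = d)
    (hK : (kalmanMatrix A B N).rank = N) {α : ℝ} (hα₀ : 0 < α) (hα₂ : α < 2)
    {μ : Measure (RSp d)} (hμ : IsNondegSpherical α μ) :
    ∃ C c : ℝ, 0 < c ∧ ∀ t ∈ Ioc (0 : ℝ) 1,
      IsSphericalWithBounds C c (sphericalPart A B α μ t) := by
  have := hμ.finite
  obtain ⟨c₁, hc₁, hlow⟩ := exists_le_norm_transported hN hB hK
  obtain ⟨c₂, hc₂, hμ2⟩ := hμ.exists_le_integral_sq hα₀ hα₂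
  obtain ⟨c₃, hc₃, hF⟩ := exists_le_integral_adjoint_flagSeries hK
  set C₀ : ℝ := ∑' k, flagBound A B k + 1 with hC₀
  have hC₀0 : 0 < C₀ := by
    have : 0 ≤ ∑' k, flagBound A B k := (norm_nonneg _).trans
      (norm_flagSeries_le (A := A) (B := B) (t := 0) (s := 0) (by simp) (by simp))
    linarith
  refine ⟨C₀ ^ α * μ.real univ, C₀ ^ (α - 2) * (c₂ * c₃), by positivity, fun t ht => ?_⟩
  have ht' : t ∈ Icc (0 : ℝ) 1 := ⟨ht.1.le, ht.2⟩
  set S := ((volume : Measure ℝ).restrict (Icc 0 1)).prod μ with hS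
  -- A continuous version of `transported`, equal to it for `s ∈ [0, 1]`; it settles all
  -- measurability questions.
  set V : ℝ × RSp d → RSp N := fun p => flagSeries A B t (projIcc 0 1 zero_le_one p.1) p.2 with hV
  have hVc : Continuous V := by
    have h1 : Continuous fun p : ℝ × RSp d => flagSeries A B t (projIcc (0 : ℝ) 1 zero_le_one p.1) := by
      refine continuousOn_flagSeries.comp_continuous (f := fun p : ℝ × RSp d =>
        (t, ((projIcc 0 1 zero_le_one p.1 : Icc (0 : ℝ) 1) : ℝ))) ?_
        fun p => ⟨ht', Subtype.coe_prop _⟩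
      fun_prop
    exact h1.clm_apply continuous_snd
  have hae1 : ∀ᵐ p ∂S, p.1 ∈ Icc (0 : ℝ) 1 :=
    Measure.quasiMeasurePreserving_fst.ae (ae_restrict_mem measurableSet_Icc)
  have hae2 : ∀ᵐ p ∂S, ‖p.2‖ = 1 :=
    Measure.quasiMeasurePreserving_snd.ae hμ.ae_norm_eq_one
  have hVt : ∀ p : ℝ × RSp d, p.1 ∈ Icc (0 : ℝ) 1 → transported A B t p.1 p.2 = V p := by
    intro p hp
    rw [transported_eq_flagSeries hN hK ht hp]
    simp only [hV, projIcc_of_mem _ hp]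
  have hVle : ∀ᵐ p ∂S, ‖V p‖ ≤ C₀ := by
    filter_upwards [hae2] with p hp
    refine ((flagSeries A B t _).le_of_opNorm_le (norm_flagSeries_le ht' (Subtype.coe_prop _)) p.2).trans ?_
    rw [hp, mul_one, hC₀]; linarith
  have hVpos : ∀ᵐ p ∂S, 0 < ‖V p‖ := by
    filter_upwards [hae1, hae2] with p h1 h2
    have := hlow t ht p.1 h1 p.2
    rw [h2, mul_one, hVt p h1] at this
    exact hc₁.trans_le this
  set w : ℝ × RSp d → ENNReal := fun p => ENNReal.ofReal (‖V p‖ ^ α) with hw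
  have hwm : Measurable w := by fun_prop
  set g : ℝ × RSp d → RSp N := fun p => ‖V p‖⁻¹ • V p with hg
  have hgm : Measurable g := (hVc.norm.measurable.inv).smul hVc.measurable
  have hσ : sphericalPart A B α μ t = (S.withDensity w).map g := by
    rw [sphericalPart, withDensity_congr_ae (g := w)]
    · refine Measure.map_congr ((withDensity_absolutelyContinuous S w).ae_le ?_)
      filter_upwards [hae1] with p hp
      simp only [hVt p hp, hg]
    · filter_upwards [hae1] with p hp
      simp only [hVt p hp, hw]
  rw [hσ]
  have hgn : ∀ᵐ p ∂S, ‖g p‖ = 1 := by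
    filter_upwards [hVpos] with p hp
    rw [hg, norm_smul, norm_inv, norm_norm, inv_mul_cancel₀ hp.ne']
  refine ⟨?_, ?_, fun ω => ?_⟩
  · rw [Measure.map_apply hgm MeasurableSet.univ, preimage_univ, withDensity_apply _ MeasurableSet.univ,
      Measure.restrict_univ]
    calc ∫⁻ p, w p ∂S ≤ ∫⁻ p, ENNReal.ofReal (C₀ ^ α) ∂S := by
          refine lintegral_mono_ae ?_
          filter_upwards [hVle] with p hp
          exact ENNReal.ofReal_le_ofReal (Real.rpow_le_rpow (norm_nonneg _) hp hα₀.le)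
      _ = _ := by
          rw [lintegral_const, hS, ← univ_prod_univ, Measure.prod_prod, ENNReal.ofReal_mul (by positivity)]
          simp
  · rw [ae_map_iff hgm.aemeasurable (measurableSet_eq_fun measurable_norm measurable_const)]
    exact (withDensity_absolutelyContinuous S w).ae_le hgn
  · have hsq : Integrable (fun p => (inner ℝ ω (V p)) ^ 2) S := by
      refine Integrable.of_bound (C := (‖ω‖ * C₀) ^ 2) (by fun_prop) ?_
      filter_upwards [hVle] with p hp
      rw [Real.norm_eq_abs, abs_pow]
      gcongr
      exact (abs_real_inner_le_norm _ _).trans (by gcongr)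
    have hint : Integrable (fun p => (w p).toReal • (inner ℝ ω (g p)) ^ 2) S := by
      refine Integrable.of_bound (C := C₀ ^ α * (‖ω‖ * 1) ^ 2) ?_ ?_
      · exact (hwm.ennreal_toReal.smul ((measurable_const.inner hgm).pow_const 2)).aestronglyMeasurable
      · filter_upwards [hVle, hgn] with p hp hp1
        rw [norm_smul, Real.norm_eq_abs, Real.norm_eq_abs, abs_pow, hw,
          ENNReal.toReal_ofReal (by positivity), abs_of_nonneg (by positivity)]
        gcongr
        exact (abs_real_inner_le_norm _ _).trans (by rw [hp1])
    rw [integral_map hgm.aemeasurable (by fun_prop),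
      integral_withDensity_eq_integral_toReal_smul hwm
        (Filter.Eventually.of_forall fun _ => ENNReal.ofReal_lt_top)]
    calc C₀ ^ (α - 2) * (c₂ * c₃) * ‖ω‖ ^ 2 = C₀ ^ (α - 2) * (c₂ * (c₃ * ‖ω‖ ^ 2)) := by ring
      _ ≤ C₀ ^ (α - 2) * (c₂ * ∫ s in Icc (0 : ℝ) 1,
          ‖ContinuousLinearMap.adjoint (flagSeries A B t s) ω‖ ^ 2) := by
        gcongr
        exact hF t ht' ω
      _ = C₀ ^ (α - 2) * ∫ s in Icc (0 : ℝ) 1,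
          c₂ * ‖ContinuousLinearMap.adjoint (flagSeries A B t s) ω‖ ^ 2 := by
        rw [integral_const_mul]
      _ ≤ C₀ ^ (α - 2) * ∫ s in Icc (0 : ℝ) 1, ∫ θ, (inner ℝ ω (V (s, θ))) ^ 2 ∂μ := by
        refine mul_le_mul_of_nonneg_left ?_ (by positivity)
        refine integral_mono_of_nonneg (Filter.Eventually.of_forall fun s => by positivity)
          hsq.integral_prod_left ?_
        filter_upwards [ae_restrict_mem measurableSet_Icc] with s hs
        refine (hμ2 _).trans_eq (integral_congr_ae (Filter.Eventually.of_forall fun θ => ?_))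
        simp only [hV, projIcc_of_mem _ hs, ContinuousLinearMap.adjoint_inner_left]
      _ = C₀ ^ (α - 2) * ∫ p, (inner ℝ ω (V p)) ^ 2 ∂S := by rw [hS, integral_prod _ hsq]
      _ = ∫ p, C₀ ^ (α - 2) * (inner ℝ ω (V p)) ^ 2 ∂S := by rw [integral_const_mul]
      _ ≤ _ := by
        refine integral_mono_ae (hsq.const_mul _) hint ?_
        filter_upwards [hVle, hVpos] with p hp hp0
        simp only [hw, hg, inner_smul_right, smul_eq_mul, mul_pow]
        rw [ENNReal.toReal_ofReal (by positivity), ← mul_assoc]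
        refine mul_le_mul_of_nonneg_right ?_ (sq_nonneg _)
        calc C₀ ^ (α - 2) ≤ ‖V p‖ ^ (α - 2) :=
              Real.rpow_le_rpow_of_nonpos hp0 hp (by linarith)
          _ = ‖V p‖ ^ α * (‖V p‖⁻¹) ^ 2 := by
              rw [Real.rpow_sub hp0, inv_pow, div_eq_mul_inv]; norm_num

end SphericalPart

/-! ### Smoothness of Lévy symbols with bounded jumps -/

section LevySymbol

open Complex

/-- The compensated Lévy–Khintchine integrand `1 - e^{ix} + ix`. -/
noncomputable def levyKernel (x : ℝ) : ℂ := 1 - cexp (I * x) + I * x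

theorem continuous_levyKernel : Continuous levyKernel := by unfold levyKernel; fun_prop

/-- Taylor's formula with integral remainder. The factor `x²` pulled out in front will make the jump
measure integrable, and what remains is a superposition of characters. -/
theorem levyKernel_eq_integral (x : ℝ) :
    levyKernel x = ∫ τ in Ioc (0 : ℝ) 1, (x : ℂ) ^ 2 * ((1 - τ : ℝ) * cexp (I * (τ * x : ℝ))) := by
  rw [← intervalIntegral.integral_of_le zero_le_one]
  -- The antiderivative comes from one integration by parts of `(1 - τ) e^{iτx}`.
  have hderiv : ∀ τ ∈ uIcc (0 : ℝ) 1, HasDerivAt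
      (fun τ : ℝ => -(I * x * (1 - τ) * cexp (I * (τ * x))) - cexp (I * (τ * x)))
      ((x : ℂ) ^ 2 * ((1 - τ : ℝ) * cexp (I * (τ * x : ℝ)))) τ := by
    intro τ _
    have h0 : HasDerivAt (fun τ : ℝ => (τ : ℂ)) 1 τ := ofRealCLM.hasDerivAt
    have h1 : HasDerivAt (fun τ : ℝ => cexp (I * (τ * x))) (cexp (I * (τ * x)) * (I * (1 * x))) τ :=
      ((h0.mul_const (x : ℂ)).const_mul I).cexp
    have h2 := ((((h0.const_sub 1).const_mul (I * (x : ℂ))).mul h1).neg).sub h1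
    refine h2.congr_deriv ?_
    push_cast
    linear_combination (-(x : ℂ) ^ 2 * (1 - τ) * cexp (I * (τ * x))) * I_sq
  rw [intervalIntegral.integral_eq_sub_of_hasDerivAt hderiv
    (Continuous.intervalIntegrable (by fun_prop) _ _)]
  simp [levyKernel]
  ring

theorem norm_levyKernel_le (x : ℝ) : ‖levyKernel x‖ ≤ x ^ 2 := by
  rw [levyKernel_eq_integral]
  refine (norm_setIntegral_le_of_norm_le_const (C := x ^ 2) (by simp) fun τ hτ => ?_).trans_eq ?_
  · rw [norm_mul, norm_mul, mul_comm I, norm_exp_ofReal_mul_I, mul_one, norm_pow, norm_real, norm_real,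
      Real.norm_eq_abs, Real.norm_eq_abs, sq_abs, abs_of_nonneg (by linarith [hτ.2])]
    exact mul_le_of_le_one_right (sq_nonneg _) (by linarith [hτ.1])
  · simp

theorem re_levyKernel (x : ℝ) : (levyKernel x).re = 1 - Real.cos x := by
  simp [levyKernel, mul_comm I, exp_ofReal_mul_I_re]

variable {N : ℕ}

/-- The symbol `∫ (1 - e^{i⟨ξ,z⟩} + i⟨ξ,z⟩) κ(dz)`. -/
noncomputable def levySymbol (κ : Measure (RSp N)) (ξ : RSp N) : ℂ :=
  ∫ z, levyKernel (inner ℝ ξ z) ∂κ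

/-- A measure carried by the unit ball, of second moment at most `M`. -/
structure HasSmallJumps (M : ℝ) (κ : Measure (RSp N)) : Prop where
  sFinite : SFinite κ
  carried : ∀ᵐ z ∂κ, ‖z‖ ≤ 1
  integrable_sq : Integrable (fun z => ‖z‖ ^ 2) κ
  integral_sq_le : ∫ z, ‖z‖ ^ 2 ∂κ ≤ M

theorem integrable_levyKernel {κ : Measure (RSp N)} (hκ : Integrable (fun z => ‖z‖ ^ 2) κ)
    (ξ : RSp N) : Integrable (fun z => levyKernel (inner ℝ ξ z)) κ := by
  refine (hκ.const_mul (‖ξ‖ ^ 2)).mono' (continuous_levyKernel.comp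
    (by fun_prop : Continuous fun z : RSp N => inner ℝ ξ z)).aestronglyMeasurable
    (Filter.Eventually.of_forall fun z => (norm_levyKernel_le _).trans ?_)
  rw [← mul_pow, ← sq_abs]
  gcongr
  exact abs_real_inner_le_norm _ _

/-- The image of `κ ⊗ dτ` on `(τ, τz, z)`. -/
noncomputable def jumpMeasure (κ : Measure (RSp N)) : Measure (ℝ × RSp N × RSp N) :=
  (κ.prod ((volume : Measure ℝ).restrict (Ioc 0 1))).map fun p => (p.2, p.2 • p.1, p.1)

/-- The bilinear form `((τ, a, z), w) ↦ -⟨a, w⟩`. -/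
noncomputable def jumpPairing (N : ℕ) : (ℝ × RSp N × RSp N) →L[ℝ] RSp N →L[ℝ] ℝ :=
  -(innerSL ℝ ∘L (ContinuousLinearMap.fst ℝ _ _ ∘L ContinuousLinearMap.snd ℝ _ _))

/-- The weight `(1 - τ) z_i z_j`. -/
noncomputable def jumpWeight (ij : Fin N × Fin N) (v : ℝ × RSp N × RSp N) : ℂ :=
  ((1 - v.1) * (v.2.2 ij.1 * v.2.2 ij.2) : ℝ)

theorem continuous_jumpWeight (ij : Fin N × Fin N) : Continuous (jumpWeight ij) := by
  unfold jumpWeight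
  fun_prop

/-- The Fourier transform `∫ e^{2πiτ⟨z,w⟩} (1 - τ) z_i z_j dτ κ(dz)`. -/
noncomputable def jumpFourier (κ : Measure (RSp N)) (ij : Fin N × Fin N) : RSp N → ℂ :=
  VectorFourier.fourierIntegral Real.fourierChar (jumpMeasure κ)
    (ContinuousLinearMap.toLinearMap₁₂ (jumpPairing N)) (jumpWeight ij)

namespace HasSmallJumps

variable {M : ℝ} {κ : Measure (RSp N)}

/-- Since `‖z‖ ≤ 1` and `τ ≤ 1`, every moment of the weight is dominated by the second moment of
`κ`. All derivatives of `jumpFourier` are therefore controlled by `M` alone. -/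
theorem norm_jump_le (hκ : HasSmallJumps M κ) (ij : Fin N × Fin N) (n : ℕ) :
    ∀ᵐ p ∂(κ.prod ((volume : Measure ℝ).restrict (Ioc 0 1))),
      ‖(p.2, p.2 • p.1, p.1)‖ ^ n * ‖jumpWeight ij (p.2, p.2 • p.1, p.1)‖ ≤ ‖p.1‖ ^ 2 := by
  have := hκ.sFinite
  have h1 : ∀ᵐ p ∂(κ.prod ((volume : Measure ℝ).restrict (Ioc 0 1))), ‖p.1‖ ≤ 1 :=
    Measure.quasiMeasurePreserving_fst.ae hκ.carried
  have h2 : ∀ᵐ p ∂(κ.prod ((volume : Measure ℝ).restrict (Ioc 0 1))), p.2 ∈ Ioc (0 : ℝ) 1 :=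
    Measure.quasiMeasurePreserving_snd.ae (ae_restrict_mem measurableSet_Ioc)
  filter_upwards [h1, h2] with p hp hτ
  have hτ1 : ‖p.2‖ ≤ 1 := by rw [Real.norm_eq_abs, abs_of_pos hτ.1]; exact hτ.2
  have e1 : ‖(p.2, p.2 • p.1, p.1)‖ ≤ 1 := by
    refine norm_prod_le_iff.2 ⟨hτ1, norm_prod_le_iff.2 ⟨?_, hp⟩⟩
    rw [norm_smul]
    exact mul_le_one₀ hτ1 (norm_nonneg _) hp
  have e2 : ‖jumpWeight ij (p.2, p.2 • p.1, p.1)‖ ≤ ‖p.1‖ ^ 2 := by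
    rw [jumpWeight, norm_real, norm_mul, norm_mul]
    refine (mul_le_of_le_one_left (by positivity) ?_).trans ?_
    · rw [Real.norm_eq_abs, abs_of_nonneg (by linarith [hτ.2])]
      linarith [hτ.1]
    · rw [sq]
      gcongr
      · exact PiLp.norm_apply_le _ _
      · exact PiLp.norm_apply_le _ _
  exact (mul_le_of_le_one_left (norm_nonneg _) (pow_le_one₀ (norm_nonneg _) e1)).trans e2

theorem measurable_jump : Measurable fun p : RSp N × ℝ => (p.2, p.2 • p.1, p.1) := by fun_prop

theorem integrable_sq_fst (hκ : HasSmallJumps M κ) :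
    Integrable (fun p : RSp N × ℝ => ‖p.1‖ ^ 2)
      (κ.prod ((volume : Measure ℝ).restrict (Ioc 0 1))) := by
  have := hκ.sFinite
  exact hκ.integrable_sq.comp_fst _

theorem integrable_jump (hκ : HasSmallJumps M κ) (ij : Fin N × Fin N) (n : ℕ) :
    Integrable (fun v => ‖v‖ ^ n * ‖jumpWeight ij v‖) (jumpMeasure κ) := by
  have hc : Continuous fun v : ℝ × RSp N × RSp N => ‖v‖ ^ n * ‖jumpWeight ij v‖ :=
    (continuous_norm.pow n).mul (continuous_jumpWeight ij).norm
  rw [jumpMeasure, integrable_map_measure hc.aestronglyMeasurable measurable_jump.aemeasurable]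
  refine hκ.integrable_sq_fst.mono' (hc.comp_aestronglyMeasurable
    measurable_jump.aestronglyMeasurable) ?_
  filter_upwards [hκ.norm_jump_le ij n] with p hp
  rw [Function.comp_apply, Real.norm_of_nonneg (by positivity)]
  exact hp

theorem integral_jump_le (hκ : HasSmallJumps M κ) (ij : Fin N × Fin N) (n : ℕ) :
    ∫ v, ‖v‖ ^ n * ‖jumpWeight ij v‖ ∂(jumpMeasure κ) ≤ M := by
  have := hκ.sFinite
  have hc : Continuous fun v : ℝ × RSp N × RSp N => ‖v‖ ^ n * ‖jumpWeight ij v‖ :=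
    (continuous_norm.pow n).mul (continuous_jumpWeight ij).norm
  rw [jumpMeasure, integral_map measurable_jump.aemeasurable hc.aestronglyMeasurable]
  refine (integral_mono_of_nonneg (Filter.Eventually.of_forall fun p => by positivity)
    hκ.integrable_sq_fst (hκ.norm_jump_le ij n)).trans ?_
  rw [integral_prod _ hκ.integrable_sq_fst]
  simpa using hκ.integral_sq_le

theorem contDiff_jumpFourier (hκ : HasSmallJumps M κ) (ij : Fin N × Fin N) {n : ℕ} :
    ContDiff ℝ n (jumpFourier κ ij) :=
  VectorFourier.contDiff_fourierIntegral (N := (n : ℕ∞)) _ fun k _ => hκ.integrable_jump ij k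

theorem norm_iteratedFDeriv_jumpFourier_le (hκ : HasSmallJumps M κ) (ij : Fin N × Fin N) (n : ℕ)
    (w : RSp N) :
    ‖iteratedFDeriv ℝ n (jumpFourier κ ij) w‖ ≤ (2 * Real.pi * ‖jumpPairing N‖) ^ n * M := by
  rw [jumpFourier, VectorFourier.iteratedFDeriv_fourierIntegral (N := (n : ℕ∞)) _
    (fun k _ => hκ.integrable_jump ij k) (continuous_jumpWeight ij).aestronglyMeasurable le_rfl]
  refine (VectorFourier.norm_fourierIntegral_le_integral_norm _ _ _ _ _).trans ?_
  have h1 : ∀ v, ‖VectorFourier.fourierPowSMulRight (jumpPairing N) (jumpWeight ij) v n‖ ≤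
      (2 * Real.pi * ‖jumpPairing N‖) ^ n * (‖v‖ ^ n * ‖jumpWeight ij v‖) := fun v => by
    rw [← mul_assoc]
    exact VectorFourier.norm_fourierPowSMulRight_le _ _ _ _
  refine (integral_mono_of_nonneg (Filter.Eventually.of_forall fun _ => norm_nonneg _)
    ((hκ.integrable_jump ij n).const_mul _) (Filter.Eventually.of_forall h1)).trans ?_
  rw [integral_const_mul]
  exact mul_le_mul_of_nonneg_left (hκ.integral_jump_le ij n) (by positivity)

/-- Insert Taylor's formula and expand `⟨w, z⟩² = ∑ w_i w_j z_i z_j`. The symbol becomes a sum of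
quadratic monomials times Fourier transforms of integrable weights, which may be differentiated at
will. The argument `2πw` matches the normalisation of `Real.fourierChar`. -/
theorem levySymbol_eq_sum (hκ : HasSmallJumps M κ) (w : RSp N) :
    levySymbol κ ((2 * Real.pi) • w) =
      ∑ ij : Fin N × Fin N, ((2 * Real.pi) ^ 2 * (w ij.1 * w ij.2) : ℝ) * jumpFourier κ ij w := by
  have := hκ.sFinite
  set ρ := κ.prod ((volume : Measure ℝ).restrict (Ioc 0 1)) with hρ
  have hJ : ∀ ij, jumpFourier κ ij w = ∫ p, cexp (I * (p.2 * (2 * Real.pi * inner ℝ w p.1) : ℝ)) *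
      jumpWeight ij (p.2, p.2 • p.1, p.1) ∂ρ := by
    intro ij
    have hc : Continuous fun v : ℝ × RSp N × RSp N =>
        Real.fourierChar (-(ContinuousLinearMap.toLinearMap₁₂ (jumpPairing N) v w)) • jumpWeight ij v := by
      have h1 : Continuous fun v : ℝ × RSp N × RSp N => -(jumpPairing N v w) := by fun_prop
      exact (Real.continuous_fourierChar.comp h1).smul (continuous_jumpWeight ij)
    rw [jumpFourier, VectorFourier.fourierIntegral, jumpMeasure, integral_map
      measurable_jump.aemeasurable hc.aestronglyMeasurable]
    refine integral_congr_ae (Filter.Eventually.of_forall fun p => ?_)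
    simp only [Circle.smul_def, Real.fourierChar_apply, smul_eq_mul]
    congr 2
    have h2 : (innerSL ℝ) p.1 w = inner ℝ w p.1 := by
      rw [innerSL_apply_apply, real_inner_comm]
    simp [jumpPairing, h2]
    ring
  have hint : ∀ ij, Integrable (fun p : RSp N × ℝ =>
      cexp (I * (p.2 * (2 * Real.pi * inner ℝ w p.1) : ℝ)) *
        jumpWeight ij (p.2, p.2 • p.1, p.1)) ρ := by
    intro ij
    refine hκ.integrable_sq_fst.mono' (Continuous.aestronglyMeasurable ?_) ?_
    · have := (continuous_jumpWeight ij).comp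
        (by fun_prop : Continuous fun p : RSp N × ℝ => (p.2, p.2 • p.1, p.1))
      fun_prop
    · filter_upwards [hκ.norm_jump_le ij 0] with p hp
      rw [norm_mul, mul_comm I, norm_exp_ofReal_mul_I]
      simpa using hp
  simp only [hJ, ← integral_const_mul]
  rw [← integral_finsetSum _ fun ij _ => (hint ij).const_mul _]
  have hker : ∀ p : RSp N × ℝ, ∑ ij : Fin N × Fin N, (((2 * Real.pi) ^ 2 * (w ij.1 * w ij.2) : ℝ) : ℂ) *
      (cexp (I * (p.2 * (2 * Real.pi * inner ℝ w p.1) : ℝ)) * jumpWeight ij (p.2, p.2 • p.1, p.1)) =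
      ((2 * Real.pi * inner ℝ w p.1 : ℝ) : ℂ) ^ 2 * ((1 - p.2 : ℝ) *
        cexp (I * (p.2 * (2 * Real.pi * inner ℝ w p.1) : ℝ))) := by
    intro p
    have hin : (inner ℝ w p.1) ^ 2 = ∑ ij : Fin N × Fin N, (w ij.1 * w ij.2) * (p.1 ij.1 * p.1 ij.2) := by
      rw [PiLp.inner_apply, sq, Finset.sum_mul_sum, Fintype.sum_prod_type]
      refine Finset.sum_congr rfl fun i _ => Finset.sum_congr rfl fun j _ => ?_
      simp; ring
    generalize cexp (I * (p.2 * (2 * Real.pi * inner ℝ w p.1) : ℝ)) = e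
    have : ((2 * Real.pi * inner ℝ w p.1 : ℝ) : ℂ) ^ 2 = (((2 * Real.pi) ^ 2 * (inner ℝ w p.1) ^ 2 : ℝ) : ℂ) := by
      push_cast; ring
    rw [this, hin, Finset.mul_sum, ofReal_sum, Finset.sum_mul]
    refine Finset.sum_congr rfl fun ij _ => ?_
    simp only [jumpWeight]
    push_cast
    ring
  have hint2 := integrable_finsetSum Finset.univ fun ij _ =>
    (hint ij).const_mul (((2 * Real.pi) ^ 2 * (w ij.1 * w ij.2) : ℝ) : ℂ)
  simp only [hker] at hint2 ⊢
  rw [hρ, integral_prod _ hint2]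
  refine integral_congr_ae (Filter.Eventually.of_forall fun z => ?_)
  simp only [inner_smul_left, levyKernel_eq_integral]
  simp

theorem contDiff_levySymbol (hκ : HasSmallJumps M κ) {n : ℕ} :
    ContDiff ℝ n fun w : RSp N => levySymbol κ ((2 * Real.pi) • w) := by
  simp only [hκ.levySymbol_eq_sum]
  refine ContDiff.sum fun ij _ => ContDiff.mul ?_ (hκ.contDiff_jumpFourier ij)
  have h1 : ContDiff ℝ n fun w : RSp N => (2 * Real.pi) ^ 2 * (w ij.1 * w ij.2) := by fun_prop
  exact ofRealCLM.contDiff.comp h1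

end HasSmallJumps

theorem exists_norm_iteratedFDeriv_levySymbol_le (N : ℕ) (M : ℝ) (hM : 0 ≤ M) (n : ℕ) :
    ∃ (k : ℕ) (D : ℝ), 1 ≤ D ∧ ∀ κ : Measure (RSp N), HasSmallJumps M κ → ∀ i ≤ n, ∀ w : RSp N,
      ‖iteratedFDeriv ℝ i (fun w : RSp N => levySymbol κ ((2 * Real.pi) • w)) w‖ ≤
        D * (1 + ‖w‖) ^ k := by
  set g : Fin N × Fin N → RSp N → ℂ := fun ij w => ((2 * Real.pi) ^ 2 * (w ij.1 * w ij.2) : ℝ) with hg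
  have hgt : ∀ ij, (g ij).HasTemperateGrowth := by
    intro ij
    have h1 : ∀ i : Fin N, Function.HasTemperateGrowth fun w : RSp N => w i := fun i =>
      (EuclideanSpace.proj i : RSp N →L[ℝ] ℝ).hasTemperateGrowth
    have h2 := ((Function.HasTemperateGrowth.const ((2 * Real.pi) ^ 2)).mul ((h1 ij.1).mul (h1 ij.2)))
    exact ofRealCLM.hasTemperateGrowth.comp h2
  choose k C hC hkC using fun ij => (hgt ij).norm_iteratedFDeriv_le_uniform n
  set K := ∑ ij, k ij with hK
  set L := 1 + 2 * Real.pi * ‖jumpPairing N‖ with hL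
  have hL1 : 1 ≤ L := by
    have : 0 ≤ 2 * Real.pi * ‖jumpPairing N‖ := by positivity
    linarith
  refine ⟨K, 1 + ∑ ij, 2 ^ n * C ij * (L ^ n * M), ?_, fun κ hκ i hi w => ?_⟩
  · have : 0 ≤ ∑ ij, 2 ^ n * C ij * (L ^ n * M) := Finset.sum_nonneg fun ij _ => by
      have := hC ij
      positivity
    linarith
  have hgc : ∀ ij, ContDiff ℝ i (g ij) := fun ij => (hgt ij).1.of_le (by exact_mod_cast le_top)
  have hterm : ∀ ij, ‖iteratedFDeriv ℝ i (fun w => g ij w * jumpFourier κ ij w) w‖ ≤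
      2 ^ n * C ij * (L ^ n * M) * (1 + ‖w‖) ^ K := by
    intro ij
    have hCij := hC ij
    refine (norm_iteratedFDeriv_mul_le (N := i) (hgc ij) (hκ.contDiff_jumpFourier ij) w le_rfl).trans ?_
    calc _ ≤ ∑ j ∈ Finset.range (i + 1), (i.choose j : ℝ) * (C ij * (1 + ‖w‖) ^ K) * (L ^ n * M) := by
          refine Finset.sum_le_sum fun j hj => ?_
          have hji : j ≤ i := Nat.lt_succ_iff.1 (Finset.mem_range.1 hj)
          gcongr
          · refine (hkC ij j (hji.trans hi) w).trans ?_
            gcongr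
            · linarith [norm_nonneg w]
            · exact Finset.single_le_sum (f := k) (fun _ _ => Nat.zero_le _) (Finset.mem_univ ij)
          · refine (hκ.norm_iteratedFDeriv_jumpFourier_le ij _ w).trans ?_
            gcongr
            calc (2 * Real.pi * ‖jumpPairing N‖) ^ (i - j) ≤ L ^ (i - j) := by
                  gcongr
                  linarith
              _ ≤ L ^ n := pow_le_pow_right₀ hL1 (by omega)
      _ = 2 ^ i * C ij * (L ^ n * M) * (1 + ‖w‖) ^ K := by
          rw [← Finset.sum_mul, ← Finset.sum_mul, ← Nat.cast_sum, Nat.sum_range_choose]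
          push_cast; ring
      _ ≤ _ := by
          gcongr
          norm_num
  have e : (fun w : RSp N => levySymbol κ ((2 * Real.pi) • w)) =
      fun w => ∑ ij, g ij w * jumpFourier κ ij w := funext hκ.levySymbol_eq_sum
  rw [e, iteratedFDeriv_fun_sum_apply fun ij _ => ((hgc ij).mul (hκ.contDiff_jumpFourier ij)).contDiffAt]
  refine (norm_sum_le_of_le _ fun ij _ => hterm ij).trans ?_
  rw [← Finset.sum_mul]
  gcongr
  linarith

/-- Translation turns into multiplication: `e^{w+z} = e^z e^w`. -/
theorem norm_iteratedFDeriv_cexp (i : ℕ) (z : ℂ) :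
    ‖iteratedFDeriv ℝ i cexp z‖ = ‖cexp z‖ * ‖iteratedFDeriv ℝ i cexp 0‖ := by
  have h1 : iteratedFDeriv ℝ i (fun w => cexp (w + z)) 0 = iteratedFDeriv ℝ i cexp (0 + z) :=
    iteratedFDeriv_comp_add_right i z 0
  have h2 : (fun w => cexp (w + z)) = cexp z • cexp := by
    ext w; simp [Complex.exp_add, mul_comm]
  rw [h2, iteratedFDeriv_const_smul_apply (Complex.contDiff_exp.contDiffAt), zero_add] at h1
  rw [← h1, norm_smul]

theorem exists_norm_iteratedFDeriv_exp_levySymbol_le (N : ℕ) (M : ℝ) (hM : 0 ≤ M) (n : ℕ) :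
    ∃ (k : ℕ) (D : ℝ), 0 ≤ D ∧ ∀ κ : Measure (RSp N), HasSmallJumps M κ → ∀ w : RSp N,
      ‖iteratedFDeriv ℝ n (fun w : RSp N => cexp (-levySymbol κ ((2 * Real.pi) • w))) w‖ ≤
        D * (1 + ‖w‖) ^ k * Real.exp (-(levySymbol κ ((2 * Real.pi) • w)).re) := by
  obtain ⟨k, D, hD, h⟩ := exists_norm_iteratedFDeriv_levySymbol_le N M hM n
  set E := ∑ i ∈ Finset.range (n + 1), ‖iteratedFDeriv ℝ i cexp 0‖ with hE
  have hE0 : 0 ≤ E := Finset.sum_nonneg fun _ _ => norm_nonneg _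
  refine ⟨k * n, n.factorial * E * D ^ n, by positivity, fun κ hκ w => ?_⟩
  -- The bound for derivatives of a composition wants the `i`-th derivative of the symbol below the
  -- `i`-th power of a single number; since this number is at least 1 and `i ≥ 1`, the uniform bound
  -- suffices.
  have hone : 1 ≤ D * (1 + ‖w‖) ^ k :=
    one_le_mul_of_one_le_of_one_le hD (one_le_pow₀ (by linarith [norm_nonneg w]))
  have := norm_iteratedFDeriv_comp_le (𝕜 := ℝ) (g := cexp) (n := n) (N := n)
    (f := fun w : RSp N => -levySymbol κ ((2 * Real.pi) • w)) Complex.contDiff_exp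
    hκ.contDiff_levySymbol.neg le_rfl w
    (C := E * Real.exp (-(levySymbol κ ((2 * Real.pi) • w)).re)) (D := D * (1 + ‖w‖) ^ k) ?_ ?_
  · refine this.trans_eq ?_
    rw [mul_pow, ← pow_mul]; ring
  · intro i hi
    rw [norm_iteratedFDeriv_cexp, Complex.norm_exp, mul_comm, neg_re]
    gcongr
    exact Finset.single_le_sum (f := fun i => ‖iteratedFDeriv ℝ i cexp 0‖)
      (fun _ _ => norm_nonneg _) (Finset.mem_range.2 (by omega))
  · intro i hi1 hi
    have e : (fun w : RSp N => -levySymbol κ ((2 * Real.pi) • w)) =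
      -(fun w : RSp N => levySymbol κ ((2 * Real.pi) • w)) := rfl
    rw [e, iteratedFDeriv_neg_apply, norm_neg]
    exact (h κ hκ i hi w).trans (le_self_pow₀ hone (by omega))

end LevySymbol

/-! ### Polar coordinates: second moment and coercivity -/

section Polar

variable {N : ℕ}

/-- The measure `dr / r^{1+α}` on `(0, ρ]`. -/
noncomputable def radialMeasure (α ρ : ℝ) : Measure ℝ :=
  ((volume : Measure ℝ).restrict (Ioc 0 ρ)).withDensity fun r => ENNReal.ofReal (1 / r ^ (1 + α))

theorem measurable_radialDensity (α : ℝ) :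
    Measurable fun r : ℝ => ENNReal.ofReal (1 / r ^ (1 + α)) := by fun_prop

instance (α ρ : ℝ) : SFinite (radialMeasure α ρ) := by unfold radialMeasure; infer_instance

theorem ae_radialMeasure_mem (α ρ : ℝ) : ∀ᵐ r ∂(radialMeasure α ρ), r ∈ Ioc 0 ρ :=
  (withDensity_absolutelyContinuous _ _).ae_le (ae_restrict_mem measurableSet_Ioc)

theorem integral_radialMeasure {E : Type*} [NormedAddCommGroup E] [NormedSpace ℝ E] (α ρ : ℝ)
    (f : ℝ → E) : ∫ r, f r ∂(radialMeasure α ρ) = ∫ r in Ioc 0 ρ, (1 / r ^ (1 + α)) • f r := by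
  rw [radialMeasure, integral_withDensity_eq_integral_toReal_smul (measurable_radialDensity α)
    (Filter.Eventually.of_forall fun _ => ENNReal.ofReal_lt_top)]
  refine setIntegral_congr_fun measurableSet_Ioc fun r hr => ?_
  have := Real.rpow_nonneg hr.1.le (1 + α)
  rw [ENNReal.toReal_ofReal (by positivity)]

theorem integrable_sq_radialMeasure {α : ℝ} (hα₂ : α < 2) :
    Integrable (fun r : ℝ => r ^ 2) (radialMeasure α 1) := by
  rw [radialMeasure, integrable_withDensity_iff (measurable_radialDensity α)
    (Filter.Eventually.of_forall fun _ => ENNReal.ofReal_lt_top)]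
  have h1 : IntegrableOn (fun r : ℝ => r ^ (1 - α)) (Ioc 0 1) :=
    (intervalIntegrable_iff_integrableOn_Ioc_of_le zero_le_one).1
      (intervalIntegral.intervalIntegrable_rpow' (by linarith))
  refine h1.congr_fun (fun r hr => ?_) measurableSet_Ioc
  have h0 := Real.rpow_nonneg hr.1.le (1 + α)
  simp only
  rw [ENNReal.toReal_ofReal (by positivity), ← Real.rpow_natCast r 2, mul_one_div,
    ← Real.rpow_sub hr.1]
  congr 1
  push_cast; ring

/-- Second moment of the jumps of size at most `a`; the coercivity estimate uses `a = 1/‖ξ‖`, and `a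
= 1` gives the total. -/
theorem integral_indicator_sq_radialMeasure {α : ℝ} (hα₂ : α < 2) {a : ℝ} (ha0 : 0 ≤ a)
    (ha1 : a ≤ 1) : ∫ r, (Ioc 0 a).indicator (fun r : ℝ => r ^ 2) r ∂(radialMeasure α 1) =
      a ^ (2 - α) / (2 - α) := by
  rw [integral_radialMeasure]
  have h1 : ∀ r ∈ Ioc (0 : ℝ) 1, (1 / r ^ (1 + α)) • (Ioc 0 a).indicator (fun r : ℝ => r ^ 2) r =
      (Ioc 0 a).indicator (fun r : ℝ => r ^ (1 - α)) r := by
    intro r hr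
    rw [← indicator_const_smul_apply] 
    by_cases hra : r ∈ Ioc 0 a
    · rw [indicator_of_mem hra, indicator_of_mem hra, smul_eq_mul, ← Real.rpow_natCast r 2,
        mul_comm, mul_one_div, ← Real.rpow_sub hr.1]
      congr 1
      push_cast; ring
    · rw [indicator_of_notMem hra, indicator_of_notMem hra]
  rw [setIntegral_congr_fun measurableSet_Ioc h1, setIntegral_indicator measurableSet_Ioc,
    inter_eq_right.2 (Ioc_subset_Ioc_right ha1), ← intervalIntegral.integral_of_le ha0,
    integral_rpow (Or.inl (by linarith)), Real.zero_rpow (by linarith), sub_zero]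
  congr 1 <;> ring_nf

theorem integral_sq_radialMeasure {α : ℝ} (hα₂ : α < 2) :
    ∫ r, r ^ 2 ∂(radialMeasure α 1) = 1 / (2 - α) := by
  have h := integral_indicator_sq_radialMeasure hα₂ zero_le_one le_rfl
  rw [Real.one_rpow] at h
  rw [← h]
  refine integral_congr_ae ?_
  filter_upwards [ae_radialMeasure_mem α 1] with r hr
  rw [indicator_of_mem hr]

theorem polarMeasure_eq (α ρ : ℝ) (σ : Measure (RSp N)) :
    polarMeasure α ρ σ = ((radialMeasure α ρ).prod σ).map fun p => p.1 • p.2 := rfl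

theorem measurable_polar : Measurable fun p : ℝ × RSp N => p.1 • p.2 := by fun_prop

namespace IsSphericalWithBounds

variable {C c : ℝ} {σ : Measure (RSp N)}

theorem isFiniteMeasure (hσ : IsSphericalWithBounds C c σ) : IsFiniteMeasure σ :=
  ⟨hσ.mass_le.trans_lt ENNReal.ofReal_lt_top⟩

theorem ae_prod (hσ : IsSphericalWithBounds C c σ) (α ρ : ℝ) :
    ∀ᵐ p ∂((radialMeasure α ρ).prod σ), p.1 ∈ Ioc 0 ρ ∧ ‖p.2‖ = 1 := by
  have := hσ.isFiniteMeasure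
  filter_upwards [Measure.quasiMeasurePreserving_fst.ae (ae_radialMeasure_mem α ρ),
    Measure.quasiMeasurePreserving_snd.ae hσ.carried] with p h1 h2 using ⟨h1, h2⟩

theorem integrable_norm_sq (hσ : IsSphericalWithBounds C c σ) :
    Integrable (fun θ => ‖θ‖ ^ 2) σ := by
  have := hσ.isFiniteMeasure
  refine (integrable_const (1 : ℝ)).congr ?_
  filter_upwards [hσ.carried] with θ hθ
  rw [hθ, one_pow]

theorem integral_norm_sq_le (hσ : IsSphericalWithBounds C c σ) (hC : 0 ≤ C) :
    ∫ θ, ‖θ‖ ^ 2 ∂σ ≤ C := by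
  have := hσ.isFiniteMeasure
  have h1 : ∫ θ, ‖θ‖ ^ 2 ∂σ = ∫ _, (1 : ℝ) ∂σ := by
    refine integral_congr_ae ?_
    filter_upwards [hσ.carried] with θ hθ
    rw [hθ, one_pow]
  rw [h1, integral_const, smul_eq_mul, mul_one]
  exact ENNReal.toReal_le_of_le_ofReal hC hσ.mass_le

theorem hasSmallJumps (hσ : IsSphericalWithBounds C c σ) (hC : 0 ≤ C) {α : ℝ} (hα₂ : α < 2) :
    HasSmallJumps (C / (2 - α)) (polarMeasure α 1 σ) := by
  have := hσ.isFiniteMeasure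
  have hmul : (fun p : ℝ × RSp N => ‖p.1 • p.2‖ ^ 2) = fun p => p.1 ^ 2 * ‖p.2‖ ^ 2 := by
    ext p; rw [norm_smul, mul_pow, Real.norm_eq_abs, sq_abs]
  refine ⟨by rw [polarMeasure_eq]; infer_instance, ?_, ?_, ?_⟩
  · rw [polarMeasure_eq, ae_map_iff measurable_polar.aemeasurable
      (measurableSet_le measurable_norm measurable_const)]
    filter_upwards [hσ.ae_prod α 1] with p hp
    rw [norm_smul, hp.2, mul_one, Real.norm_eq_abs, abs_of_pos hp.1.1]
    exact hp.1.2
  · rw [polarMeasure_eq, integrable_map_measure (by fun_prop) measurable_polar.aemeasurable]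
    refine Integrable.congr ((integrable_sq_radialMeasure hα₂).mul_prod hσ.integrable_norm_sq) ?_
    exact Filter.Eventually.of_forall fun p => (congrFun hmul p).symm
  · rw [polarMeasure_eq, integral_map measurable_polar.aemeasurable (by fun_prop), hmul,
      integral_prod_mul (fun r : ℝ => r ^ 2) (fun θ : RSp N => ‖θ‖ ^ 2),
      integral_sq_radialMeasure hα₂, one_div, mul_comm, ← div_eq_mul_inv]
    have := hσ.integral_norm_sq_le hC
    have : 0 < 2 - α := by linarith
    gcongr

/-- The real part is `∫ (1 - cos)`. For `‖ξ‖ > 1` keep only the jumps `r ≤ 1/‖ξ‖`: there the phase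
is at most 1, `1 - cos x ≥ 2x²/π²` applies, and the second moment `‖ξ‖^{α-2}/(2-α)` times `c ‖ξ‖²`
produces `‖ξ‖^α`. The `-1` makes the left side nonpositive when `‖ξ‖ ≤ 1`, where nothing has to be
proved. -/
theorem le_re_levySymbol (hσ : IsSphericalWithBounds C c σ) (hC : 0 ≤ C) (hc : 0 ≤ c) {α : ℝ}
    (hα₀ : 0 < α) (hα₂ : α < 2) (ξ : RSp N) :
    2 / Real.pi ^ 2 * c / (2 - α) * (‖ξ‖ ^ α - 1) ≤ (levySymbol (polarMeasure α 1 σ) ξ).re := by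
  have := hσ.isFiniteMeasure
  have hα' : 0 < 2 - α := by linarith
  have hint := integrable_levyKernel (hσ.hasSmallJumps hC hα₂).integrable_sq ξ
  have hre : (levySymbol (polarMeasure α 1 σ) ξ).re =
      ∫ p, (1 - Real.cos (p.1 * inner ℝ ξ p.2)) ∂((radialMeasure α 1).prod σ) := by
    have h1 := Complex.reCLM.integral_comp_comm hint
    simp only [Complex.reCLM_apply, re_levyKernel] at h1
    rw [levySymbol, ← h1, polarMeasure_eq, integral_map measurable_polar.aemeasurable (by fun_prop)]
    simp only [inner_smul_right]
  have hint2 : Integrable (fun p : ℝ × RSp N => 1 - Real.cos (p.1 * inner ℝ ξ p.2))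
      ((radialMeasure α 1).prod σ) := by
    have h1 := hint.re
    simp only [RCLike.re_eq_complex_re, re_levyKernel] at h1
    rw [polarMeasure_eq, integrable_map_measure (by fun_prop) measurable_polar.aemeasurable] at h1
    simpa only [Function.comp_def, inner_smul_right] using h1
  rw [hre]
  rcases le_or_gt ‖ξ‖ 1 with hξ | hξ
  · refine (mul_nonpos_of_nonneg_of_nonpos (by positivity) ?_).trans
      (integral_nonneg fun p => sub_nonneg.2 (Real.cos_le_one _))
    rw [sub_nonpos]
    exact Real.rpow_le_one (norm_nonneg _) hξ hα₀.le
  have hξ0 : 0 < ‖ξ‖ := by linarith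
  calc 2 / Real.pi ^ 2 * c / (2 - α) * (‖ξ‖ ^ α - 1)
      ≤ 2 / Real.pi ^ 2 * c / (2 - α) * ‖ξ‖ ^ α := by gcongr; linarith
    _ = ‖ξ‖⁻¹ ^ (2 - α) / (2 - α) * (2 / Real.pi ^ 2 * (c * ‖ξ‖ ^ 2)) := by
      have : ‖ξ‖ ^ α = ‖ξ‖⁻¹ ^ (2 - α) * ‖ξ‖ ^ 2 := by
        rw [Real.inv_rpow hξ0.le, ← Real.rpow_neg hξ0.le, ← Real.rpow_natCast,
          ← Real.rpow_add hξ0]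
        congr 1; push_cast; ring
      rw [this]; ring
    _ ≤ ‖ξ‖⁻¹ ^ (2 - α) / (2 - α) * (2 / Real.pi ^ 2 * ∫ θ, (inner ℝ ξ θ) ^ 2 ∂σ) := by
      have := hσ.lower ξ
      gcongr
    _ = ∫ p, (Ioc 0 ‖ξ‖⁻¹).indicator (fun r : ℝ => r ^ 2) p.1 *
          (2 / Real.pi ^ 2 * (inner ℝ ξ p.2) ^ 2) ∂((radialMeasure α 1).prod σ) := by
      rw [integral_prod_mul (fun r : ℝ => (Ioc 0 ‖ξ‖⁻¹).indicator (fun r : ℝ => r ^ 2) r)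
        (fun θ : RSp N => 2 / Real.pi ^ 2 * (inner ℝ ξ θ) ^ 2), integral_const_mul,
        integral_indicator_sq_radialMeasure hα₂ (by positivity) (inv_le_one_of_one_le₀ hξ.le)]
    _ ≤ _ := by
      refine integral_mono_of_nonneg (Filter.Eventually.of_forall fun p => ?_) hint2 ?_
      · exact mul_nonneg (indicator_nonneg (fun _ _ => sq_nonneg _) _) (by positivity)
      filter_upwards [hσ.ae_prod α 1] with p hp
      by_cases hpr : p.1 ∈ Ioc 0 ‖ξ‖⁻¹
      · rw [indicator_of_mem hpr]
        have habs : |p.1 * inner ℝ ξ p.2| ≤ Real.pi := by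
          rw [abs_mul, abs_of_pos hpr.1]
          calc p.1 * |inner ℝ ξ p.2| ≤ ‖ξ‖⁻¹ * (‖ξ‖ * ‖p.2‖) := by
                gcongr
                · exact hpr.2
                · exact abs_real_inner_le_norm _ _
            _ = 1 := by rw [hp.2, mul_one, inv_mul_cancel₀ hξ0.ne']
            _ ≤ Real.pi := by linarith [Real.pi_gt_three]
        have := Real.cos_le_one_sub_mul_cos_sq habs
        rw [mul_pow] at this
        linarith
      · rw [indicator_of_notMem hpr, zero_mul]
        exact sub_nonneg.2 (Real.cos_le_one _)

end IsSphericalWithBounds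

end Polar

/-! ### Rapid decay of the characteristic functions -/

section Decay

open Filter Topology

/-- A single term of the exponential series, of order `n ≥ k/α`, already beats `x^k` for `x > 1`. -/
theorem exists_pow_mul_exp_neg_rpow_le {α a : ℝ} (hα : 0 < α) (ha : 0 < a) (k : ℕ) :
    ∃ D : ℝ, ∀ x : ℝ, 0 ≤ x → (1 + x) ^ k * Real.exp (-(a * x ^ α)) ≤ D := by
  obtain ⟨n, hn⟩ := exists_nat_ge (k / α)
  have hn' : (k : ℝ) ≤ n * α := by rwa [div_le_iff₀ hα] at hn
  refine ⟨2 ^ k * (1 + n.factorial / a ^ n), fun x hx => ?_⟩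
  have hpos : 0 ≤ a * x ^ α := by positivity
  have hexp : Real.exp (-(a * x ^ α)) ≤ 1 := Real.exp_le_one_iff.2 (by linarith)
  rcases le_or_gt x 1 with hx1 | hx1
  · have h1 : (1 + x) ^ k ≤ 2 ^ k := by gcongr; linarith
    calc (1 + x) ^ k * Real.exp (-(a * x ^ α)) ≤ 2 ^ k * 1 := by gcongr
      _ ≤ _ := by
        gcongr
        have : 0 ≤ n.factorial / a ^ n := by positivity
        linarith
  · have h1 : (a * x ^ α) ^ n / n.factorial ≤ Real.exp (a * x ^ α) := Real.pow_div_factorial_le_exp _ hpos n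
    have h2 : x ^ k ≤ (x ^ α) ^ n := by
      rw [← Real.rpow_natCast, ← Real.rpow_natCast, ← Real.rpow_mul hx]
      exact Real.rpow_le_rpow_of_exponent_le hx1.le (by linarith)
    have h3 : x ^ k ≤ n.factorial / a ^ n * Real.exp (a * x ^ α) := by
      rw [mul_pow, div_le_iff₀ (by positivity)] at h1
      rw [div_mul_eq_mul_div, le_div_iff₀ (by positivity)]
      have := mul_le_mul_of_nonneg_left h2 (by positivity : 0 ≤ a ^ n)
      linarith
    calc (1 + x) ^ k * Real.exp (-(a * x ^ α)) ≤ (2 * x) ^ k * Real.exp (-(a * x ^ α)) := by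
          gcongr; linarith
      _ = 2 ^ k * (x ^ k * Real.exp (-(a * x ^ α))) := by rw [mul_pow]; ring
      _ ≤ 2 ^ k * (n.factorial / a ^ n * Real.exp (a * x ^ α) * Real.exp (-(a * x ^ α))) := by gcongr
      _ = 2 ^ k * (n.factorial / a ^ n) := by rw [mul_assoc (_ / _), ← Real.exp_add]; simp
      _ ≤ _ := by gcongr; linarith

/-- The Fourier side density `exp (-Ψ(2πw))` and its derivatives decay rapidly, uniformly in the
spherical measure. -/
theorem exists_decay_exp_levySymbol (N : ℕ) {C c α : ℝ} (hC : 0 ≤ C) (hc : 0 < c) (hα₀ : 0 < α)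
    (hα₂ : α < 2) (k n : ℕ) :
    ∃ D : ℝ, ∀ σ : Measure (RSp N), IsSphericalWithBounds C c σ → ∀ w : RSp N,
      ‖w‖ ^ k * ‖iteratedFDeriv ℝ n (fun w : RSp N => Complex.exp
        (-levySymbol (polarMeasure α 1 σ) ((2 * Real.pi) • w))) w‖ ≤ D := by
  have hα' : 0 < 2 - α := by linarith
  obtain ⟨j, D₁, hD₁, h1⟩ := exists_norm_iteratedFDeriv_exp_levySymbol_le N (C / (2 - α))
    (by positivity) n
  set b := 2 / Real.pi ^ 2 * c / (2 - α) with hb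
  have hb0 : 0 < b := by positivity
  obtain ⟨D₂, h2⟩ := exists_pow_mul_exp_neg_rpow_le hα₀ hb0 (k + j)
  refine ⟨D₁ * Real.exp b * D₂, fun σ hσ w => ?_⟩
  have hpi : 1 ≤ 2 * Real.pi := by linarith [Real.pi_gt_three]
  -- Coercivity at `2πw`, weakened by `2π ≥ 1`; its `-1` becomes the factor `e^b`.
  have h3 : Real.exp (-(levySymbol (polarMeasure α 1 σ) ((2 * Real.pi) • w)).re) ≤
      Real.exp b * Real.exp (-(b * ‖w‖ ^ α)) := by
    rw [← Real.exp_add, Real.exp_le_exp]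
    have h4 := hσ.le_re_levySymbol hC hc.le hα₀ hα₂ ((2 * Real.pi) • w)
    have h5 : ‖w‖ ^ α ≤ ‖(2 * Real.pi) • w‖ ^ α := by
      refine Real.rpow_le_rpow (norm_nonneg _) ?_ hα₀.le
      rw [norm_smul, Real.norm_of_nonneg (by positivity)]
      exact le_mul_of_one_le_left (norm_nonneg _) hpi
    rw [← hb] at h4
    nlinarith
  calc _ ≤ (1 + ‖w‖) ^ k * (D₁ * (1 + ‖w‖) ^ j * (Real.exp b * Real.exp (-(b * ‖w‖ ^ α)))) := by
        refine mul_le_mul ?_ ((h1 _ (hσ.hasSmallJumps hC hα₂) w).trans (by gcongr))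
          (norm_nonneg _) (by positivity)
        gcongr
        linarith
    _ = D₁ * Real.exp b * ((1 + ‖w‖) ^ (k + j) * Real.exp (-(b * ‖w‖ ^ α))) := by
        rw [pow_add]; ring
    _ ≤ _ := by
        gcongr
        exact h2 _ (norm_nonneg _)

end Decay

/-! ### Positivity of the Fourier transform of `exp (-Ψ)` -/

section Positivity

open Complex Filter Topology ComplexOrder

variable {N : ℕ}

/-- The Fourier integral of `φ`, damped by any centred Gaussian, is nonnegative. -/
def HasNonnegGaussianMeans (φ : RSp N → ℂ) : Prop :=
  ∀ δ : ℝ, 0 < δ → ∀ y : RSp N,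
    0 ≤ ∫ w, cexp (-δ * ‖w‖ ^ 2) * cexp ((-2 * Real.pi * inner ℝ w y : ℝ) * I) * φ w

theorem norm_gaussian (δ : ℝ) (w : RSp N) : ‖cexp (-δ * ‖w‖ ^ 2)‖ = Real.exp (-δ * ‖w‖ ^ 2) := by
  rw [Complex.norm_exp]
  congr 1
  have : (-δ * ‖w‖ ^ 2 : ℂ) = ((-δ * ‖w‖ ^ 2 : ℝ) : ℂ) := by push_cast; ring
  rw [this, ofReal_re]

theorem integrable_gaussian {δ : ℝ} (hδ : 0 < δ) :
    Integrable fun w : RSp N => Real.exp (-δ * ‖w‖ ^ 2) := by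
  have h := (GaussianFourier.integrable_cexp_neg_mul_sq_norm_add (V := RSp N) (b := δ)
    (by simpa using hδ) 0 0).norm
  refine h.congr (Filter.Eventually.of_forall fun w => ?_)
  simp only [zero_mul, add_zero]
  exact norm_gaussian δ w

/-- By Fubini the damped integral is the integral against `P` of the Fourier transform of a
Gaussian, which is again a positive Gaussian, centred at `y`. -/
theorem HasNonnegGaussianMeans.of_charFun (P : Measure (RSp N)) [IsFiniteMeasure P] :
    HasNonnegGaussianMeans fun w => charFun P ((2 * Real.pi) • w) := by
  intro δ hδ y
  have h1 : ∀ w : RSp N, cexp (-δ * ‖w‖ ^ 2) * cexp ((-2 * Real.pi * inner ℝ w y : ℝ) * I) *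
      charFun P ((2 * Real.pi) • w) = ∫ x, cexp (-δ * ‖w‖ ^ 2) *
        (cexp ((-2 * Real.pi * inner ℝ w y : ℝ) * I) * cexp (inner ℝ x ((2 * Real.pi) • w) * I)) ∂P := by
    intro w
    rw [charFun_apply, mul_assoc, ← integral_const_mul, ← integral_const_mul]
  simp only [h1]
  have hint : Integrable (Function.uncurry fun (w x : RSp N) => cexp (-δ * ‖w‖ ^ 2) *
        (cexp ((-2 * Real.pi * inner ℝ w y : ℝ) * I) *
          cexp (inner ℝ x ((2 * Real.pi) • w) * I))) (volume.prod P) := by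
    have h2 : Integrable (fun p : RSp N × RSp N => Real.exp (-δ * ‖p.1‖ ^ 2)) (volume.prod P) :=
      (integrable_gaussian hδ).comp_fst P
    refine h2.mono' (Continuous.aestronglyMeasurable ?_) (Filter.Eventually.of_forall fun p => ?_)
    · unfold Function.uncurry; fun_prop
    · rw [Function.uncurry, norm_mul, norm_mul, norm_exp_ofReal_mul_I, norm_exp_ofReal_mul_I,
        norm_gaussian, mul_one, mul_one]
  rw [integral_integral_swap hint]
  have h3 : ∀ x : RSp N, ∫ w : RSp N, cexp (-δ * ‖w‖ ^ 2) *
        (cexp ((-2 * Real.pi * inner ℝ w y : ℝ) * I) * cexp (inner ℝ x ((2 * Real.pi) • w) * I)) =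
      (((Real.pi / δ) ^ (Module.finrank ℝ (RSp N) / 2 : ℝ) *
        Real.exp (-Real.pi ^ 2 * ‖x - y‖ ^ 2 / δ) : ℝ) : ℂ) := by
    intro x
    have h4 := fourier_gaussian_innerProductSpace' (b := δ) (by simpa using hδ) x y
    rw [Real.fourier_eq'] at h4
    have h5 : (((Real.pi / δ) ^ (Module.finrank ℝ (RSp N) / 2 : ℝ) : ℝ) : ℂ) =
        ((Real.pi : ℂ) / δ) ^ (Module.finrank ℝ (RSp N) / 2 : ℂ) := by
      rw [ofReal_cpow (by positivity)]; push_cast; rfl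
    rw [ofReal_mul, h5, ofReal_exp]
    push_cast
    rw [← h4]
    refine integral_congr_ae (Filter.Eventually.of_forall fun w => ?_)
    simp only [smul_eq_mul, ← Complex.exp_add, inner_smul_right]
    congr 1
    push_cast
    ring
  simp only [h3]
  exact_mod_cast integral_nonneg fun x => by positivity

/-- The Gaussian factor supplies the dominating function, so no integrability of the limit is
required. -/
theorem HasNonnegGaussianMeans.of_tendsto {φ : ℕ → RSp N → ℂ} {ψ : RSp N → ℂ} {C : ℝ}
    (h : ∀ n, HasNonnegGaussianMeans (φ n)) (hm : ∀ n, Measurable (φ n))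
    (hC : ∀ n w, ‖φ n w‖ ≤ C) (hlim : ∀ w, Tendsto (fun n => φ n w) atTop (𝓝 (ψ w))) :
    HasNonnegGaussianMeans ψ := by
  intro δ hδ y
  refine ge_of_tendsto' (tendsto_integral_of_dominated_convergence
    (fun w : RSp N => Real.exp (-δ * ‖w‖ ^ 2) * C) (fun n => ?_) ((integrable_gaussian hδ).mul_const C)
    (fun n => Filter.Eventually.of_forall fun w => ?_)
    (Filter.Eventually.of_forall fun w => (hlim w).const_mul _)) fun n => h n δ hδ y
  · have := hm n
    exact (Measurable.mul (by fun_prop) this).aestronglyMeasurable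
  · rw [norm_mul, norm_mul, norm_exp_ofReal_mul_I, norm_gaussian, mul_one]
    have := hC n w
    gcongr

/-- `φ` is the characteristic function of a finite measure. -/
def IsFiniteCharFun (φ : RSp N → ℂ) : Prop :=
  ∃ P : Measure (RSp N), IsFiniteMeasure P ∧ charFun P = φ

namespace IsFiniteCharFun

variable {φ ψ : RSp N → ℂ}

theorem mul (hφ : IsFiniteCharFun φ) (hψ : IsFiniteCharFun ψ) :
    IsFiniteCharFun fun ξ => φ ξ * ψ ξ := by
  obtain ⟨P, hP, rfl⟩ := hφ
  obtain ⟨Q, hQ, rfl⟩ := hψ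
  exact ⟨P ∗ Q, inferInstance, funext fun ξ => charFun_conv ξ⟩

theorem add (hφ : IsFiniteCharFun φ) (hψ : IsFiniteCharFun ψ) :
    IsFiniteCharFun fun ξ => φ ξ + ψ ξ := by
  obtain ⟨P, hP, rfl⟩ := hφ
  obtain ⟨Q, hQ, rfl⟩ := hψ
  refine ⟨P + Q, inferInstance, funext fun ξ => ?_⟩
  simp only [charFun_apply]
  have h : ∀ R : Measure (RSp N), [IsFiniteMeasure R] →
      Integrable (fun x => cexp (inner ℝ x ξ * I)) R := fun R _ =>
    Integrable.of_bound (C := 1) (by fun_prop) (Filter.Eventually.of_forall fun x => by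
      rw [norm_exp_ofReal_mul_I])
  exact integral_add_measure (h P) (h Q)

theorem const_mul {c : ℝ} (hc : 0 ≤ c) (hφ : IsFiniteCharFun φ) :
    IsFiniteCharFun fun ξ => c * φ ξ := by
  obtain ⟨P, hP, rfl⟩ := hφ
  refine ⟨ENNReal.ofReal c • P, P.smul_finite ENNReal.ofReal_ne_top, funext fun ξ => ?_⟩
  rw [charFun_apply, integral_smul_measure, ENNReal.toReal_ofReal hc, charFun_apply, real_smul]

theorem exp_inner (b : RSp N) : IsFiniteCharFun fun ξ => cexp (inner ℝ b ξ * I) :=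
  ⟨Measure.dirac b, inferInstance, funext fun ξ => charFun_dirac ξ⟩

theorem one : IsFiniteCharFun fun _ : RSp N => 1 := by simpa using exp_inner (0 : RSp N)

theorem zero : IsFiniteCharFun fun _ : RSp N => 0 := by simpa using (one (N := N)).const_mul le_rfl

theorem pow (hφ : IsFiniteCharFun φ) (n : ℕ) : IsFiniteCharFun fun ξ => φ ξ ^ n := by
  induction n with
  | zero => simpa using one
  | succ n ih => simpa only [pow_succ] using ih.mul hφ

theorem sum {φ : ℕ → RSp N → ℂ} (hφ : ∀ n, IsFiniteCharFun (φ n)) (K : ℕ) :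
    IsFiniteCharFun fun ξ => ∑ n ∈ Finset.range K, φ n ξ := by
  induction K with
  | zero => simpa using zero
  | succ K ih => simpa only [Finset.sum_range_succ] using ih.add (hφ K)

theorem measurable (hφ : IsFiniteCharFun φ) : Measurable φ := by
  obtain ⟨P, hP, rfl⟩ := hφ
  exact measurable_charFun

theorem hasNonnegGaussianMeans (hφ : IsFiniteCharFun φ) :
    HasNonnegGaussianMeans fun w => φ ((2 * Real.pi) • w) := by
  obtain ⟨P, hP, rfl⟩ := hφ
  exact .of_charFun P

end IsFiniteCharFun

theorem levySymbol_of_finite (ν : Measure (RSp N)) [IsFiniteMeasure ν]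
    (hν : Integrable (fun z => z) ν) (ξ : RSp N) :
    levySymbol ν ξ = ν.real univ - charFun ν ξ + inner ℝ (∫ z, z ∂ν) ξ * I := by
  have h1 : Integrable (fun z => cexp (inner ℝ z ξ * I)) ν :=
    Integrable.of_bound (C := 1) (by fun_prop) (Filter.Eventually.of_forall fun x => by
      rw [norm_exp_ofReal_mul_I])
  have h2 : Integrable (fun z => inner ℝ ξ z) ν := hν.const_inner ξ
  have h3 : ∀ z, levyKernel (inner ℝ ξ z) =
      1 - cexp (inner ℝ z ξ * I) + ((inner ℝ ξ z : ℝ) : ℂ) * I := fun z => by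
    rw [levyKernel, real_inner_comm z ξ, mul_comm I]
  rw [levySymbol]
  simp only [h3]
  have h4 : Integrable (fun z => 1 - cexp (inner ℝ z ξ * I)) ν := (integrable_const _).sub h1
  have h5 : Integrable (fun z => ((inner ℝ ξ z : ℝ) : ℂ) * I) ν := h2.ofReal.mul_const I
  rw [integral_add h4 h5, integral_sub (integrable_const _) h1, integral_mul_const,
    integral_complex_ofReal, integral_inner hν,
    charFun_apply, real_inner_comm ξ]
  simp

theorem re_levySymbol_nonneg {κ : Measure (RSp N)} (hκ : Integrable (fun z => ‖z‖ ^ 2) κ)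
    (ξ : RSp N) : 0 ≤ (levySymbol κ ξ).re := by
  have h1 := Complex.reCLM.integral_comp_comm (integrable_levyKernel hκ ξ)
  simp only [Complex.reCLM_apply, re_levyKernel] at h1
  rw [levySymbol, ← h1]
  exact integral_nonneg fun z => sub_nonneg.2 (Real.cos_le_one _)

theorem norm_exp_neg_levySymbol_le {κ : Measure (RSp N)} (hκ : Integrable (fun z => ‖z‖ ^ 2) κ)
    (ξ : RSp N) : ‖cexp (-levySymbol κ ξ)‖ ≤ 1 := by
  rw [Complex.norm_exp, neg_re]
  exact Real.exp_le_one_iff.2 (neg_nonpos.2 (re_levySymbol_nonneg hκ ξ))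

theorem measurable_exp_neg_levySymbol_of_finite (ν : Measure (RSp N)) [IsFiniteMeasure ν]
    (hν : Integrable (fun z => z) ν) :
    Measurable fun w : RSp N => cexp (-levySymbol ν ((2 * Real.pi) • w)) := by
  simp only [levySymbol_of_finite ν hν]
  have : Measurable fun w : RSp N => charFun ν ((2 * Real.pi) • w) :=
    measurable_charFun.comp (by fun_prop)
  fun_prop

/-- Compound Poisson case: with mass `l` and mean `b`, `exp(-Ψ) = e^{-l} e^{-i⟨b,ξ⟩} ∑ (charFun ν)^n
/ n!`. Each partial sum is the characteristic function of a finite measure built from convolution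
powers, and all are bounded by `e^{-l} e^l`. -/
theorem hasNonnegGaussianMeans_exp_of_finite (ν : Measure (RSp N)) [IsFiniteMeasure ν]
    (hν : Integrable (fun z => z) ν) :
    HasNonnegGaussianMeans fun w => cexp (-levySymbol ν ((2 * Real.pi) • w)) := by
  set b := ∫ z, z ∂ν with hb
  set l := ν.real univ with hl
  set φ : ℕ → RSp N → ℂ := fun K ξ => (Real.exp (-l) : ℝ) * (cexp (inner ℝ (-b) ξ * I) *
    ∑ n ∈ Finset.range K, ((n.factorial : ℝ)⁻¹ : ℝ) * charFun ν ξ ^ n) with hφ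
  have hchar : IsFiniteCharFun (charFun ν) := ⟨ν, inferInstance, rfl⟩
  have hφS : ∀ K, IsFiniteCharFun (φ K) := fun K =>
    ((IsFiniteCharFun.exp_inner (-b)).mul (IsFiniteCharFun.sum
      (fun n => (hchar.pow n).const_mul (by positivity)) K)).const_mul (Real.exp_nonneg _)
  refine .of_tendsto (C := Real.exp (-l) * Real.exp l) (fun K => (hφS K).hasNonnegGaussianMeans)
    (fun K => (hφS K).measurable.comp (by fun_prop)) ?_ ?_
  · intro K w
    simp only [hφ, norm_mul, norm_exp_ofReal_mul_I, norm_real, one_mul, Real.norm_eq_abs,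
      abs_of_pos (Real.exp_pos (-l))]
    gcongr
    refine (norm_sum_le _ _).trans ((Finset.sum_le_sum fun n _ => ?_).trans
      (Real.sum_le_exp_of_nonneg (measureReal_nonneg) K))
    rw [norm_mul, norm_pow, norm_real, norm_inv, Real.norm_natCast, inv_mul_eq_div]
    gcongr
    exact norm_charFun_le _
  · intro w
    set ξ := (2 * Real.pi) • w
    have h1 : Tendsto (fun K => ∑ n ∈ Finset.range K, (((n.factorial : ℝ)⁻¹ : ℝ) : ℂ) * charFun ν ξ ^ n)
        atTop (𝓝 (cexp (charFun ν ξ))) := by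
      have h2 := (NormedSpace.exp_series_hasSum_exp' (𝕂 := ℂ) (charFun ν ξ)).tendsto_sum_nat
      rw [← Complex.exp_eq_exp_ℂ] at h2
      simpa using h2
    have h3 : cexp (-levySymbol ν ξ) = (Real.exp (-l) : ℝ) * (cexp (inner ℝ (-b) ξ * I) *
        cexp (charFun ν ξ)) := by
      rw [levySymbol_of_finite ν hν, ofReal_exp, ← Complex.exp_add, ← Complex.exp_add, ← hb, ← hl]
      congr 1
      rw [inner_neg_left]
      push_cast
      ring
    rw [h3]
    exact (h1.const_mul _).const_mul _

theorem tendsto_levySymbol_restrict {κ : Measure (RSp N)} (hκ : Integrable (fun z => ‖z‖ ^ 2) κ)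
    (ξ : RSp N) : Tendsto (fun n : ℕ => levySymbol (κ.restrict {z | 1 / ((n : ℝ) + 1) ≤ ‖z‖}) ξ)
      atTop (𝓝 (levySymbol κ ξ)) := by
  have hmeas : ∀ n : ℕ, MeasurableSet {z : RSp N | 1 / ((n : ℝ) + 1) ≤ ‖z‖} := fun n =>
    measurableSet_le measurable_const measurable_norm
  have hint := integrable_levyKernel hκ ξ
  simp only [levySymbol, ← integral_indicator (hmeas _)]
  refine tendsto_integral_of_dominated_convergence (fun z => ‖levyKernel (inner ℝ ξ z)‖)
    (fun n => hint.aestronglyMeasurable.indicator (hmeas n)) hint.norm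
    (fun n => Filter.Eventually.of_forall fun z => norm_indicator_le_norm_self _ _)
    (Filter.Eventually.of_forall fun z => ?_)
  rcases eq_or_ne z 0 with rfl | hz
  · have h0 : levyKernel (inner ℝ ξ (0 : RSp N)) = 0 := by simp [levyKernel]
    have : ∀ n : ℕ, ({z : RSp N | 1 / ((n : ℝ) + 1) ≤ ‖z‖}.indicator
        (fun z => levyKernel (inner ℝ ξ z)) 0) = 0 := fun n => by
      rw [indicator_apply_eq_zero]; exact fun _ => h0
    simp only [this, h0]
    exact tendsto_const_nhds
  · refine (tendsto_const_nhds (x := levyKernel (inner ℝ ξ z))).congr' ?_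
    filter_upwards [tendsto_one_div_add_atTop_nhds_zero_nat.eventually_lt_const
      (norm_pos_iff.2 hz)] with n hn
    rw [indicator_of_mem (show z ∈ {z : RSp N | 1 / ((n : ℝ) + 1) ≤ ‖z‖} from hn.le)]

/-- `exp (-Ψ)` is positive definite for every Lévy–Khintchine symbol `Ψ`. -/
theorem hasNonnegGaussianMeans_exp_levySymbol {κ : Measure (RSp N)}
    (hκ : Integrable (fun z => ‖z‖ ^ 2) κ) :
    HasNonnegGaussianMeans fun w => cexp (-levySymbol κ ((2 * Real.pi) • w)) := by
  -- Chebyshev: a finite second moment leaves finite mass away from the origin.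
  have hfin : ∀ n : ℕ, IsFiniteMeasure (κ.restrict {z | 1 / ((n : ℝ) + 1) ≤ ‖z‖}) := by
    intro n
    have h := hκ.measure_ge_lt_top (ε := (1 / ((n : ℝ) + 1)) ^ 2) (by positivity)
    refine ⟨?_⟩
    rw [Measure.restrict_apply_univ]
    refine (measure_mono fun z hz => ?_).trans_lt h
    have hz2 : (1 / ((n : ℝ) + 1)) ^ 2 ≤ ‖z‖ ^ 2 := pow_le_pow_left₀ (by positivity) hz 2
    exact hz2
  have hid : ∀ n : ℕ, Integrable (fun z => z) (κ.restrict {z | 1 / ((n : ℝ) + 1) ≤ ‖z‖}) := by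
    intro n
    have := hfin n
    refine ((integrable_const (1 : ℝ)).add hκ.restrict).mono' (by fun_prop)
      (Filter.Eventually.of_forall fun z => ?_)
    simp only [Pi.add_apply]
    nlinarith [sq_nonneg (‖z‖ - 1), norm_nonneg z]
  refine .of_tendsto (C := 1) (fun n => ?_) (fun n => ?_) (fun n w => ?_)
    (fun w => ((tendsto_levySymbol_restrict hκ ((2 * Real.pi) • w)).neg).cexp)
  · have := hfin n
    exact hasNonnegGaussianMeans_exp_of_finite _ (hid n)
  · have := hfin n
    exact measurable_exp_neg_levySymbol_of_finite _ (hid n)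
  · exact norm_exp_neg_levySymbol_le hκ.restrict _

open FourierTransform in
-- Take `δ = 1/(n+1)` and let `n` grow; integrability of `φ` now gives the domination.
theorem HasNonnegGaussianMeans.fourier_nonneg {φ : RSp N → ℂ} (h : HasNonnegGaussianMeans φ)
    (hφ : Integrable φ) (y : RSp N) : 0 ≤ 𝓕 φ y := by
  rw [Real.fourier_eq']
  have hlim : ∀ w : RSp N, Tendsto (fun n : ℕ => cexp (-(1 / ((n : ℝ) + 1) : ℝ) * ‖w‖ ^ 2) *
      cexp ((-2 * Real.pi * inner ℝ w y : ℝ) * I) * φ w) atTop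
      (𝓝 (cexp ((-2 * Real.pi * inner ℝ w y : ℝ) * I) • φ w)) := by
    intro w
    have h1 : Tendsto (fun n : ℕ => cexp (-(1 / ((n : ℝ) + 1) : ℝ) * ‖w‖ ^ 2)) atTop (𝓝 1) := by
      have h2 : Tendsto (fun x : ℝ => cexp (-(x : ℂ) * ‖w‖ ^ 2)) (𝓝 0) (𝓝 1) := by
        have : Continuous fun x : ℝ => cexp (-(x : ℂ) * ‖w‖ ^ 2) := by fun_prop
        simpa using this.tendsto 0
      exact h2.comp tendsto_one_div_add_atTop_nhds_zero_nat
    have := (h1.mul_const (cexp ((-2 * Real.pi * inner ℝ w y : ℝ) * I))).mul_const (φ w)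
    rwa [one_mul] at this
  refine ge_of_tendsto' (tendsto_integral_of_dominated_convergence (fun w => ‖φ w‖)
    (fun n => ?_) hφ.norm (fun n => Filter.Eventually.of_forall fun w => ?_)
    (Filter.Eventually.of_forall hlim)) fun n => h _ Nat.one_div_pos_of_nat y
  · exact AEStronglyMeasurable.mul (Continuous.aestronglyMeasurable (by fun_prop))
      hφ.aestronglyMeasurable
  · rw [norm_mul, norm_mul, norm_exp_ofReal_mul_I, norm_gaussian, mul_one]
    refine mul_le_of_le_one_left (norm_nonneg _) (Real.exp_le_one_iff.2 ?_)
    rw [neg_mul, neg_nonpos]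
    positivity

end Positivity

/-! ### A bounded family of Schwartz densities -/

section Density

open Complex FourierTransform SchwartzMap ComplexOrder

/-- The decay constants do not depend on `σ`, so the functions `exp(-Ψ_σ(2π·))` form a bounded set
in Schwartz space. A continuous linear map, here the Fourier transform followed by the real part,
keeps it bounded; uniformity in `t` rests on this. -/
theorem exists_schwartz_density (N : ℕ) {C c α : ℝ} (hC : 0 ≤ C) (hc : 0 < c) (hα₀ : 0 < α)
    (hα₂ : α < 2) :
    ∃ q : {σ : Measure (RSp N) // IsSphericalWithBounds C c σ} → 𝓢(RSp N, ℝ),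
      (∀ σ x, 0 ≤ q σ x) ∧
      (∀ σ ξ, ∫ x, cexp (inner ℝ x ξ * I) * q σ x = cexp (-levySymbol (polarMeasure α 1 σ) ξ)) ∧
      Bornology.IsVonNBounded ℝ (range q) := by
  choose D hD using exists_decay_exp_levySymbol N hC hc hα₀ hα₂
  set f : {σ : Measure (RSp N) // IsSphericalWithBounds C c σ} → 𝓢(RSp N, ℂ) := fun σ =>
    { toFun := fun w => cexp (-levySymbol (polarMeasure α 1 σ) ((2 * Real.pi) • w))
      smooth' := contDiff_infty.2 fun n =>
        Complex.contDiff_exp.comp (σ.2.hasSmallJumps hC hα₂).contDiff_levySymbol.neg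
      decay' := fun k n => ⟨D k n, hD k n σ σ.2⟩ } with hf
  have hfapp : ∀ σ w, f σ w = cexp (-levySymbol (polarMeasure α 1 σ) ((2 * Real.pi) • w)) :=
    fun _ _ => rfl
  set T : 𝓢(RSp N, ℂ) →L[ℝ] 𝓢(RSp N, ℝ) :=
    (postcompCLM reCLM).comp (fourierTransformCLM ℝ) with hT
  have hnonneg : ∀ σ y, 0 ≤ 𝓕 (f σ) y := fun σ y => by
    rw [fourier_coe]
    exact (hasNonnegGaussianMeans_exp_levySymbol
      (σ.2.hasSmallJumps hC hα₂).integrable_sq).fourier_nonneg (f σ).integrable y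
  have hTapp : ∀ σ y, T (f σ) y = (𝓕 (f σ) y).re := fun _ _ => rfl
  -- Nonnegativity in the order of `ℂ` includes being real, so taking the real part loses nothing.
  have hTc : ∀ σ y, ((T (f σ) y : ℝ) : ℂ) = 𝓕 (f σ) y := fun σ y => by
    rw [hTapp]
    exact (Complex.eq_re_of_ofReal_le (hnonneg σ y)).symm
  refine ⟨fun σ => T (f σ), fun σ x => ?_, fun σ ξ => ?_, ?_⟩
  · rw [hTapp]
    exact (Complex.le_def.1 (hnonneg σ x)).1
  · simp only [hTc]
    have h1 : 𝓕⁻ (𝓕 (f σ)) ((2 * Real.pi)⁻¹ • ξ) = f σ ((2 * Real.pi)⁻¹ • ξ) := by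
      rw [FourierTransform.fourierInv_fourier_eq]
    rw [fourierInv_coe, Real.fourierInv_eq', hfapp, smul_smul, mul_inv_cancel₀ (by positivity),
      one_smul] at h1
    rw [← h1]
    refine integral_congr_ae (Filter.Eventually.of_forall fun x => ?_)
    simp only [smul_eq_mul, inner_smul_right]
    congr 4
    field_simp
  · have hb : Bornology.IsVonNBounded ℝ (range f) := by
      rw [(schwartz_withSeminorms ℝ (RSp N) ℂ).isVonNBounded_iff_seminorm_bounded]
      rintro ⟨k, n⟩
      refine ⟨max (D k n) 0 + 1, by positivity, ?_⟩
      rintro _ ⟨σ, rfl⟩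
      refine lt_of_le_of_lt (SchwartzMap.seminorm_le_bound ℝ k n (f σ) (le_max_right _ _)
        fun w => (hD k n σ σ.2 w).trans (le_max_left _ _)) (lt_add_one _)
    rw [range_comp' T f]
    exact hb.image T

end Density

/-! ### Mixed partial derivatives as values of the iterated derivative -/

section MultiDeriv

variable {N : ℕ}

theorem pderivative_iteratedFDeriv {f : RSp N → ℝ} (hf : ContDiff ℝ (⊤ : ℕ∞) f) {n : ℕ}
    (v : Fin n → RSp N) (i : Fin N) :
    pderivative i (fun y => iteratedFDeriv ℝ n f y v) = fun y =>
      iteratedFDeriv ℝ (n + 1) f y (Fin.cons (EuclideanSpace.single i (1 : ℝ)) v) := by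
  funext y
  have hd : DifferentiableAt ℝ (iteratedFDeriv ℝ n f) y :=
    hf.differentiable_iteratedFDeriv (by exact_mod_cast WithTop.coe_lt_top n) y
  have hd2 : HasFDerivAt (fun y => iteratedFDeriv ℝ n f y v)
      ((ContinuousMultilinearMap.apply ℝ (fun _ : Fin n => RSp N) ℝ v).comp
        (fderiv ℝ (iteratedFDeriv ℝ n f) y)) y :=
    (ContinuousMultilinearMap.apply ℝ (fun _ : Fin n => RSp N) ℝ v).hasFDerivAt.comp y
      hd.hasFDerivAt
  rw [pderivative, hd2.differentiableAt.lineDeriv_eq_fderiv, hd2.fderiv,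
    iteratedFDeriv_succ_apply_left]
  simp

/-- Each partial derivative prepends one basis vector to the arguments of the iterated derivative.
This links multi-index derivatives with Schwartz seminorms. -/
theorem exists_multiDeriv_eq {f : RSp N → ℝ} (hf : ContDiff ℝ (⊤ : ℕ∞) f) (ϑ : Fin N → ℕ) :
    ∃ v : Fin (∑ i, ϑ i) → RSp N, (∀ j, ‖v j‖ ≤ 1) ∧
      multiDeriv ϑ f = fun y => iteratedFDeriv ℝ (∑ i, ϑ i) f y v := by
  have hiter : ∀ (i : Fin N) (n k : ℕ) (v : Fin n → RSp N), (∀ j, ‖v j‖ ≤ 1) →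
      ∃ v' : Fin (k + n) → RSp N, (∀ j, ‖v' j‖ ≤ 1) ∧
        (pderivative i)^[k] (fun y => iteratedFDeriv ℝ n f y v) =
          fun y => iteratedFDeriv ℝ (k + n) f y v' := by
    intro i n k v hv
    induction k with
    | zero =>
      rw [Nat.zero_add]
      exact ⟨v, hv, rfl⟩
    | succ k ih =>
      obtain ⟨v', hv', h⟩ := ih
      have e : k + 1 + n = k + n + 1 := by ring
      rw [e, Function.iterate_succ_apply', h, pderivative_iteratedFDeriv hf]
      refine ⟨_, fun j => ?_, rfl⟩
      refine Fin.cases ?_ (fun j => ?_) j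
      · simp
      · simpa using hv' j
  have hlist : ∀ l : List (Fin N), ∃ v : Fin (l.map ϑ).sum → RSp N, (∀ j, ‖v j‖ ≤ 1) ∧
      l.foldr (fun i g => (pderivative i)^[ϑ i] g) f =
        fun y => iteratedFDeriv ℝ (l.map ϑ).sum f y v := by
    intro l
    induction l with
    | nil => exact ⟨fun _ => 0, by simp, funext fun y => (iteratedFDeriv_zero_apply _).symm⟩
    | cons i l ih =>
      obtain ⟨v, hv, h⟩ := ih
      obtain ⟨v', hv', h'⟩ := hiter i _ (ϑ i) v hv
      rw [List.foldr_cons, h, h', List.map_cons, List.sum_cons]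
      exact ⟨v', hv', rfl⟩
  have hsum : ((List.finRange N).map ϑ).sum = ∑ i, ϑ i := by
    rw [← List.ofFn_eq_map, List.sum_ofFn]
  rw [← hsum]
  exact hlist _

theorem abs_multiDeriv_le {f : RSp N → ℝ} (hf : ContDiff ℝ (⊤ : ℕ∞) f) (ϑ : Fin N → ℕ)
    (y : RSp N) : |multiDeriv ϑ f y| ≤ ‖iteratedFDeriv ℝ (∑ i, ϑ i) f y‖ := by
  obtain ⟨v, hv, h⟩ := exists_multiDeriv_eq hf ϑ
  rw [h]
  refine ((iteratedFDeriv ℝ (∑ i, ϑ i) f y).le_opNorm v).trans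
    (mul_le_of_le_one_right (norm_nonneg _) (Finset.prod_le_one (fun _ _ => norm_nonneg _)
      fun j _ => hv j))

end MultiDeriv

/-! ### Self-similarity of the truncated symbol -/

section Scaling

theorem radialMeasure_restrict {α ρ l : ℝ} (hl : l ≤ ρ) :
    (radialMeasure α ρ).restrict (Iic l) = radialMeasure α l := by
  rw [radialMeasure, restrict_withDensity measurableSet_Iic, Measure.restrict_restrict
    measurableSet_Iic, radialMeasure]
  congr 2
  ext r
  simp only [mem_inter_iff, mem_Iic, mem_Ioc]
  constructor
  · rintro ⟨h1, h2, _⟩; exact ⟨h2, h1⟩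
  · rintro ⟨h1, h2⟩; exact ⟨h2, h1, h2.trans hl⟩

/-- Homogeneity of `dr / r^(1+α)`: the density contributes `l^(1+α)` and Lebesgue measure `l⁻¹`. -/
theorem map_radialMeasure {α l : ℝ} (hl : 0 < l) :
    (radialMeasure α 1).map (fun r => l * r) = ENNReal.ofReal (l ^ α) • radialMeasure α l := by
  have hm : Measurable fun r : ℝ => l * r := by fun_prop
  ext s hs
  rw [Measure.map_apply hm hs, Measure.smul_apply, smul_eq_mul, radialMeasure, radialMeasure,
    withDensity_apply _ (hm hs), withDensity_apply _ hs, Measure.restrict_restrict (hm hs),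
    Measure.restrict_restrict hs, ← lintegral_indicator ((hm hs).inter measurableSet_Ioc),
    ← lintegral_indicator (hs.inter measurableSet_Ioc)]
  have hG : Measurable ((s ∩ Ioc 0 l).indicator fun r : ℝ => ENNReal.ofReal (1 / r ^ (1 + α))) :=
    (measurable_radialDensity α).indicator (hs.inter measurableSet_Ioc)
  have h1 : ∀ r, ((fun r : ℝ => l * r) ⁻¹' s ∩ Ioc 0 1).indicator
      (fun r : ℝ => ENNReal.ofReal (1 / r ^ (1 + α))) r = ENNReal.ofReal (l ^ (1 + α)) *
        (s ∩ Ioc 0 l).indicator (fun r : ℝ => ENNReal.ofReal (1 / r ^ (1 + α))) (l * r) := by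
    intro r
    have hiff : r ∈ (fun r : ℝ => l * r) ⁻¹' s ∩ Ioc 0 1 ↔ l * r ∈ s ∩ Ioc 0 l := by
      simp only [mem_inter_iff, mem_preimage, mem_Ioc, mul_pos_iff_of_pos_left hl,
        mul_le_iff_le_one_right hl]
    by_cases hr : r ∈ (fun r : ℝ => l * r) ⁻¹' s ∩ Ioc 0 1
    · have hr0 : 0 < r := hr.2.1
      rw [indicator_of_mem hr, indicator_of_mem (hiff.1 hr), ← ENNReal.ofReal_mul (by positivity),
        Real.mul_rpow hl.le hr0.le]
      congr 1
      have := Real.rpow_pos_of_pos hl (1 + α)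
      field_simp
    · rw [indicator_of_notMem hr, indicator_of_notMem (fun h => hr (hiff.2 h)), mul_zero]
  simp only [h1]
  have h2 : ∀ G : ℝ → ENNReal, Measurable G → ∀ c, ∫⁻ r, c * G (l * r) =
      c * (ENNReal.ofReal |l⁻¹| * ∫⁻ r, G r) := fun G hG c => by
    rw [lintegral_const_mul _ (by fun_prop), ← lintegral_map hG hm,
      Real.map_volume_mul_left hl.ne', lintegral_smul_measure, smul_eq_mul]
  rw [h2 _ hG, ← mul_assoc, ← ENNReal.ofReal_mul (by positivity)]
  congr 2
  rw [abs_of_pos (by positivity), Real.rpow_add hl, Real.rpow_one]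
  field_simp

variable {N d : ℕ}

/-- With `l = t^(1/α)` the rescaling factor `l^α` is exactly the time `t`. The hypothesis `l ≤ ρ`
says that the truncation acts before the cutoff of the Lévy measure, so that `ρ` disappears from the
right-hand side. -/
theorem mul_setIntegral_levyKernel_polarMeasure {C c : ℝ} {σ : Measure (RSp N)}
    (hσ : IsSphericalWithBounds C c σ) {α ρ t : ℝ} (hα₀ : 0 < α) (ht : 0 < t)
    (hρ : t ^ (1 / α) ≤ ρ) (ξ : RSp N) :
    t * ∫ z in Metric.closedBall (0 : RSp N) (t ^ (1 / α)), levyKernel (inner ℝ ξ z)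
      ∂(polarMeasure α ρ σ) = levySymbol (polarMeasure α 1 σ) (t ^ (1 / α) • ξ) := by
  have := hσ.isFiniteMeasure
  set l := t ^ (1 / α) with hl
  have hl0 : 0 < l := Real.rpow_pos_of_pos ht _
  have hlα : l ^ α = t := by
    rw [hl, ← Real.rpow_mul ht.le, one_div_mul_cancel hα₀.ne', Real.rpow_one]
  have hcont : Continuous fun z : RSp N => levyKernel (inner ℝ ξ z) :=
    continuous_levyKernel.comp (by fun_prop)
  -- For almost every `(r, θ)` one has `|rθ| = r`, so the ball condition is just `r ≤ l`.
  have h1 : ((radialMeasure α ρ).prod σ).restrict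
      ((fun p : ℝ × RSp N => p.1 • p.2) ⁻¹' Metric.closedBall 0 l) = (radialMeasure α l).prod σ := by
    rw [← radialMeasure_restrict hρ, ← Measure.restrict_univ (μ := σ), Measure.prod_restrict,
      Measure.restrict_univ]
    refine Measure.restrict_congr_set ?_
    filter_upwards [hσ.ae_prod α ρ] with p hp
    refine propext ?_
    change p.1 • p.2 ∈ Metric.closedBall 0 l ↔ p ∈ Iic l ×ˢ univ
    simp [norm_smul, hp.2, abs_of_pos hp.1.1]
  rw [polarMeasure_eq, Measure.restrict_map measurable_polar Metric.isClosed_closedBall.measurableSet,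
    h1, integral_map measurable_polar.aemeasurable hcont.aestronglyMeasurable]
  have h2 : (t : ℂ) * ∫ p, levyKernel (inner ℝ ξ (p.1 • p.2)) ∂((radialMeasure α l).prod σ) =
      ∫ p, levyKernel (inner ℝ ξ (p.1 • p.2)) ∂((ENNReal.ofReal t • radialMeasure α l).prod σ) := by
    rw [Measure.prod_smul_left, integral_smul_measure, ENNReal.toReal_ofReal ht.le, Complex.real_smul]
  have h3 : (((radialMeasure α 1).map fun r => l * r).prod σ) =
      ((radialMeasure α 1).prod σ).map (Prod.map (fun r => l * r) id) := by
    rw [← Measure.map_prod_map _ _ (by fun_prop) measurable_id, Measure.map_id]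
  have hcont2 : Continuous fun p : ℝ × RSp N => levyKernel (inner ℝ ξ (p.1 • p.2)) :=
    continuous_levyKernel.comp (by fun_prop)
  have hcont3 : Continuous fun z : RSp N => levyKernel (inner ℝ (l • ξ) z) :=
    continuous_levyKernel.comp (by fun_prop)
  rw [h2, ← hlα, ← map_radialMeasure hl0, h3, integral_map (by fun_prop)
    hcont2.aestronglyMeasurable,
    levySymbol, polarMeasure_eq, integral_map measurable_polar.aemeasurable
    hcont3.aestronglyMeasurable]
  simp only [Prod.map_fst, Prod.map_snd, id, inner_smul_right, inner_smul_left, mul_assoc]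
  refine integral_congr_ae (Filter.Eventually.of_forall fun p => ?_)
  simp only [conj_trivial]
  congr 1
  ring

end Scaling

/-! ### The density and its estimates -/

theorem mainTheorem9 (N d : ℕ) (hN : 1 ≤ N)
    (A : Matrix (Fin N) (Fin N) ℝ) (B : Matrix (Fin N) (Fin d) ℝ)
    (hB : B.rank = d) (hK : (kalmanMatrix A B N).rank = N)
    (α : ℝ) (hα₀ : 0 < α) (hα₂ : α < 2) (r₀ : ℝ) (hr₀ : 0 < r₀)
    (μ : MeasureTheory.Measure (RSp d)) (hμ : IsNondegSpherical α μ) (m : ℕ) :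
    ∃ T₀ : ℝ, 0 < T₀ ∧ T₀ ≤ 1 ∧ ∃ p : ℝ → RSp N → ℝ,
      (∀ t ∈ Set.Ioc (0 : ℝ) T₀,
        (∀ y, 0 ≤ p t y) ∧ ContDiff ℝ m (p t) ∧
        IsTruncLaw A B α r₀ μ t
          ((MeasureTheory.volume : MeasureTheory.Measure (RSp N)).withDensity
            fun y => ENNReal.ofReal (p t y))) ∧
      ∀ k : ℕ, k ≤ m → ∃ C : ℝ, 0 < C ∧
        ∀ ϑ : Fin N → ℕ, ∑ i, ϑ i = k →
          ∀ t ∈ Set.Ioc (0 : ℝ) T₀, ∀ y : RSp N,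
            |multiDeriv ϑ (p t) y| ≤
              C * t ^ (-(((N : ℝ) + k) / α)) * (1 + ‖y‖ / t ^ (1 / α)) ^ ((k : ℤ) - (m : ℤ)) := by
  classical
  obtain ⟨C₁, c, hc, hσ₁⟩ := exists_isSphericalWithBounds hN hB hK hα₀ hα₂ hμ
  set C := max C₁ 0 with hCdef
  have hC : 0 ≤ C := le_max_right _ _
  have hσ : ∀ t ∈ Ioc (0 : ℝ) 1, IsSphericalWithBounds C c (sphericalPart A B α μ t) := fun t ht =>
    ⟨(hσ₁ t ht).mass_le.trans (ENNReal.ofReal_le_ofReal (le_max_left _ _)), (hσ₁ t ht).carried,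
      (hσ₁ t ht).lower⟩
  obtain ⟨q, hq0, hqF, hqb⟩ := exists_schwartz_density N hC hc hα₀ hα₂
  set ρ := r₀ * transportedInf A B with hρdef
  have hρ : 0 < ρ := mul_pos hr₀ (transportedInf_pos hN hB hK)
  have hρα : 0 < ρ ^ α := Real.rpow_pos_of_pos hρ α
  set Q : ℝ → SchwartzMap (RSp N) ℝ := fun t =>
    if ht : t ∈ Ioc (0 : ℝ) 1 then q ⟨_, hσ t ht⟩ else 0 with hQ
  have hQt : ∀ t (ht : t ∈ Ioc (0 : ℝ) 1), Q t = q ⟨_, hσ t ht⟩ := fun t ht => dif_pos ht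
  -- `t ≤ ρ^α` is the scaling condition `t^(1/α) ≤ ρ`; `t ≤ 1` gives the uniform spherical bounds.
  refine ⟨min 1 (ρ ^ α), lt_min one_pos hρα, min_le_left _ _,
    fun t y => (t ^ (1 / α))⁻¹ ^ N * Q t ((t ^ (1 / α))⁻¹ • y), fun t ht => ?_, fun k hk => ?_⟩
  · have ht1 : t ∈ Ioc (0 : ℝ) 1 := ⟨ht.1, ht.2.trans (min_le_left _ _)⟩
    have hl0 : 0 < t ^ (1 / α) := Real.rpow_pos_of_pos ht.1 _
    have hlρ : t ^ (1 / α) ≤ ρ := by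
      have h1 := Real.rpow_le_rpow ht.1.le (ht.2.trans (min_le_right _ _)) (one_div_nonneg.2 hα₀.le)
      rwa [← Real.rpow_mul hρ.le, mul_one_div_cancel hα₀.ne', Real.rpow_one] at h1
    have hsymb : ∀ ξ, (t : ℂ) * truncSymbol A B α r₀ μ t ξ =
        levySymbol (polarMeasure α 1 (sphericalPart A B α μ t)) (t ^ (1 / α) • ξ) := fun ξ =>
      mul_setIntegral_levyKernel_polarMeasure (hσ t ht1) hα₀ ht.1 hlρ ξ
    set l := t ^ (1 / α) with hl
    have hnonneg : ∀ y, 0 ≤ l⁻¹ ^ N * Q t (l⁻¹ • y) := fun y => by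
      rw [hQt t ht1]
      exact mul_nonneg (by positivity) (hq0 _ _)
    have hcont : Continuous fun y => l⁻¹ ^ N * Q t (l⁻¹ • y) := by
      have := (Q t).continuous
      fun_prop
    have hchar : ∀ ξ : RSp N, charFun ((volume : Measure (RSp N)).withDensity
        fun y => ENNReal.ofReal (l⁻¹ ^ N * Q t (l⁻¹ • y))) ξ =
        Complex.exp (-(t * truncSymbol A B α r₀ μ t ξ)) := by
      intro ξ
      rw [hsymb, ← hqF ⟨_, hσ t ht1⟩, charFun_apply, integral_withDensity_eq_integral_toReal_smul
        (by fun_prop) (Filter.Eventually.of_forall fun _ => ENNReal.ofReal_lt_top), ← hQt t ht1]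
      have h1 := Measure.integral_comp_inv_smul (volume : Measure (RSp N)) (fun x =>
        Complex.exp (inner ℝ x (l • ξ) * Complex.I) * Q t x) l
      rw [finrank_euclideanSpace_fin, abs_of_pos (by positivity)] at h1
      have h2 : ∫ x, Complex.exp (inner ℝ x (l • ξ) * Complex.I) * Q t x = (l ^ N)⁻¹ • ∫ x,
          Complex.exp (inner ℝ (l⁻¹ • x) (l • ξ) * Complex.I) * Q t (l⁻¹ • x) := by
        rw [h1, smul_smul, inv_mul_cancel₀ (by positivity), one_smul]
      rw [h2, ← integral_smul]
      refine integral_congr_ae (Filter.Eventually.of_forall fun y => ?_)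
      simp only [ENNReal.toReal_ofReal (hnonneg y), inner_smul_left, inner_smul_right,
        Complex.real_smul, conj_trivial]
      rw [← mul_assoc l, mul_inv_cancel₀ hl0.ne', one_mul]
      push_cast
      rw [inv_pow]
      ring
    refine ⟨hnonneg, ?_, ⟨?_⟩, hchar⟩
    · exact contDiff_const.mul (((Q t).smooth m).comp (contDiff_const_smul _))
    -- The total mass is the characteristic function at 0, where the symbol vanishes.
    · have h0 := hchar 0
      rw [charFun_zero, hsymb, smul_zero] at h0
      have h2 : levySymbol (polarMeasure α 1 (sphericalPart A B α μ t)) 0 = 0 := by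
        simp [levySymbol, levyKernel]
      rw [h2, neg_zero, Complex.exp_zero] at h0
      have h3 : ((volume : Measure (RSp N)).withDensity
        fun y => ENNReal.ofReal (l⁻¹ ^ N * Q t (l⁻¹ • y))).real univ = 1 := by exact_mod_cast h0
      rwa [Measure.real, ENNReal.toReal_eq_one_iff] at h3
  -- Weight `m - k` on the derivative of order `k` is what the exponent `k - m` asks for; one `r`
  -- bounds these seminorms for the whole family. The factor `2^(m-k)` is the price of `1 + ‖x‖` in
  -- place of `‖x‖`.
  · obtain ⟨r, hr0, hr⟩ := (schwartz_withSeminorms ℝ (RSp N)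
      ℝ).isVonNBounded_iff_finset_seminorm_bounded.1 hqb (Finset.Iic (m - k, k))
    refine ⟨2 ^ (m - k) * r, by positivity, fun ϑ hϑ t ht y => ?_⟩
    have ht1 : t ∈ Ioc (0 : ℝ) 1 := ⟨ht.1, ht.2.trans (min_le_left _ _)⟩
    have hl0 : 0 < t ^ (1 / α) := Real.rpow_pos_of_pos ht.1 _
    have htl : t ^ (-(((N : ℝ) + k) / α)) = (t ^ (1 / α))⁻¹ ^ (N + k) := by
      rw [← Real.rpow_neg ht.1.le, ← Real.rpow_natCast, ← Real.rpow_mul ht.1.le]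
      congr 1
      push_cast
      ring
    set l := t ^ (1 / α) with hl
    have hsm : ContDiff ℝ (⊤ : ℕ∞) fun y => Q t (l⁻¹ • y) :=
      ((Q t).smooth ⊤).comp (contDiff_const_smul _)
    refine (abs_multiDeriv_le (contDiff_const.mul hsm) ϑ y).trans ?_
    rw [hϑ]
    have e1 : (fun y => l⁻¹ ^ N * Q t (l⁻¹ • y)) = l⁻¹ ^ N • fun y => Q t (l⁻¹ • y) := rfl
    rw [e1, iteratedFDeriv_const_smul_apply (hsm.of_le (by exact_mod_cast le_top)).contDiffAt,
      iteratedFDeriv_comp_const_smul _ ((Q t).smooth k), smul_smul, ← pow_add, norm_smul,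
      Real.norm_of_nonneg (by positivity), htl]
    have h1 := SchwartzMap.one_add_le_sup_seminorm_apply (𝕜 := ℝ) (m := (m - k, k)) le_rfl le_rfl
      (Q t) (l⁻¹ • y)
    have h2 : ((Finset.Iic (m - k, k)).sup fun m => SchwartzMap.seminorm ℝ m.1 m.2) (Q t) ≤ r := by
      rw [hQt t ht1]
      exact (hr _ (mem_range_self _)).le
    have h3 : ‖l⁻¹ • y‖ = ‖y‖ / l := by
      rw [norm_smul, norm_inv, Real.norm_of_nonneg hl0.le, inv_mul_eq_div]
    rw [h3] at h1
    have hpos : 0 < 1 + ‖y‖ / l := by positivity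
    have h4 : (1 + ‖y‖ / l) ^ ((k : ℤ) - (m : ℤ)) = ((1 + ‖y‖ / l) ^ (m - k))⁻¹ := by
      rw [← zpow_natCast, ← zpow_neg]
      congr 1
      push_cast [hk]
      ring
    have h5 : ‖iteratedFDeriv ℝ k (Q t) (l⁻¹ • y)‖ ≤
        2 ^ (m - k) * r * ((1 + ‖y‖ / l) ^ (m - k))⁻¹ := by
      rw [← div_eq_mul_inv, le_div_iff₀ (by positivity), mul_comm]
      exact h1.trans (by gcongr)
    rw [h4]
    calc l⁻¹ ^ (N + k) * ‖iteratedFDeriv ℝ k (Q t) (l⁻¹ • y)‖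
        ≤ l⁻¹ ^ (N + k) * (2 ^ (m - k) * r * ((1 + ‖y‖ / l) ^ (m - k))⁻¹) := by gcongr
      _ = _ := by ring
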